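/- A $(0,1)$-matrix is *simple* if it has no repeated columns; write $\|A\|$ for its number of columns. A matrix $F$ is a *configuration* in $A$ if some submatrix of $A$ is a row and column permutation of $F$. Let $F(0,p,1,0)$ be the $2\times(p+1)$ matrix with $p$ columns $\binom{1}{0}$ and one column $\binom{0}{1}$, and let $\mathrm{Avoid}(m,F(0,p,1,0))$ be the set of simple $m$-rowed $(0,1)$-matrices in which $F(0,p,1,0)$ is not a configuration. Put $$c_3=\tfrac73,\quad c_4=\tfrac{11}4,\quad c_5=\tfrac{15}4,\quad c_6=\tfrac{21}5,\quad c_7=\tfrac{24}5,\quad c_8=\tfrac{27}5,\quad c_9=\tfrac{31}5 .$$ For $A\in\mathrm{Avoid}(m,F(0,p,1,0))$ let $G(A)$ be the following graph on the rows of $A$. For distinct rows $i,j$ there is a directed edge $i\to j$ if no column of $A$ has a $0$ in row $i$ and a $1$ in row $j$. There is an undirected edge $i-j$ if at most $p-1$ columns have a $0$ in row $i$ and a $1$ in row $j$, and at most $p-1$ columns have a $1$ in row $i$ and a $0$ in row $j$, and there is no directed edge between $i$ and $j$ in either direction. The *components of $G(A)$ induced by the undirected edges* are the connected components of the graph formed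 by the undirected edges on all rows. A *deletion* is the removal of some $s\ge 0$ rows and $t\ge 0$ columns from $A$ such that the remaining matrix is simple (all $m$ rows may be removed; a matrix without rows is simple if and only if it has at most one column). Its *cost* is $c_p s-t$. **Lemma.** Let $p\in\{3,4,5,6,7,8,9\}$, let $m$ be given, and let $A\in\mathrm{Avoid}(m,F(0,p,1,0))$. Then every component of $G(A)$ induced by the undirected edges is a clique of undirected edges, or there is a deletion of cost at least $1$. Moreover, in either case, $\|A\|\le c_p m+1$. -/

import Mathlib

namespace ForbConfig

/-- A (0,1)-matrix with rows indexed by `ρ` and columns indexed by `κ`. The entries are the two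
elements `0` and `1` of `Fin 2`. -/
abbrev BinMatrix (ρ κ : Type*) := Matrix ρ κ (Fin 2)

/-- A (0,1)-matrix is simple if it has no repeated columns. (A matrix with no rows is simple exactly
when it has at most one column.) -/
def IsSimple {ρ κ : Type*} (A : BinMatrix ρ κ) : Prop :=
  Function.Injective A.col

/-- `F` is a configuration in `A` (written `F ≺ A`): some submatrix of `A` is a row and column
permutation of `F`. -/
def HasConfig {α β ρ κ : Type*} (F : BinMatrix α β) (A : BinMatrix ρ κ) : Prop :=
  ∃ (f : α ↪ ρ) (g : β ↪ κ), A.submatrix f g = F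

/-- The matrices of `Avoid(m, F)` that have `n` columns: simple, `m`-rowed, without configuration
`F`. -/
def Avoid {α β : Type*} (m n : ℕ) (F : BinMatrix α β) : Set (BinMatrix (Fin m) (Fin n)) :=
  {A | IsSimple A ∧ ¬ HasConfig F A}

/-- The `2 × (p+1)` matrix `F(0,p,1,0)`: its first `p` columns are `(1,0)ᵀ` and its last column is
`(0,1)ᵀ`. -/
def F0p10 (p : ℕ) : BinMatrix (Fin 2) (Fin (p + 1)) :=
  Matrix.of fun i j => if (i = 0 ↔ j.val < p) then 1 else 0

/-- The number of columns of `A` that have a `0` in row `i` and a `1` in row `j`. -/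
def count01 {ρ κ : Type*} [Fintype κ] (A : BinMatrix ρ κ) (i j : ρ) : ℕ :=
  (Finset.univ.filter fun k => A i k = 0 ∧ A j k = 1).card

/-- The directed edge `i → j` of `G(A)`: no column has a `0` in row `i` and a `1` in row `j`. -/
def DirEdge {ρ κ : Type*} [Fintype κ] (A : BinMatrix ρ κ) (i j : ρ) : Prop :=
  i ≠ j ∧ count01 A i j = 0

/-- The graph of the undirected edges of `G(A)`: `i - j` if each of the patterns `(0,1)ᵀ`, `(1,0)ᵀ`
occurs at most `p - 1` times on the rows `i, j`; this edge is ignored when `i, j` are joined by a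
directed edge. -/
def undirectedGraph {ρ κ : Type*} [Fintype κ] (p : ℕ) (A : BinMatrix ρ κ) : SimpleGraph ρ where
  Adj i j := i ≠ j ∧ (count01 A i j ≤ p - 1 ∧ count01 A j i ≤ p - 1) ∧
    ¬ DirEdge A i j ∧ ¬ DirEdge A j i
  symm := ⟨fun _ _ h => ⟨h.1.symm, ⟨h.2.1.2, h.2.1.1⟩, h.2.2.2, h.2.2.1⟩⟩
  loopless := ⟨fun _ h => h.1 rfl⟩

/-- The matrix that is left when the rows in `S` and the columns in `T` are deleted from `A`. -/
def deleteRowsCols {ρ κ : Type*} (A : BinMatrix ρ κ) (S : Finset ρ) (T : Finset κ) :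
    BinMatrix {i // i ∉ S} {j // j ∉ T} :=
  A.submatrix Subtype.val Subtype.val

/-- The constants `c_p`, for `3 ≤ p ≤ 9`; the value at other `p` is irrelevant. -/
def c : ℕ → ℚ
  | 3 => 7 / 3
  | 4 => 11 / 4
  | 5 => 15 / 4
  | 6 => 21 / 5
  | 7 => 24 / 5
  | 8 => 27 / 5
  | 9 => 31 / 5
  | _ => 0

/-- The cost `c_p s - t` of a deletion of `s` rows and `t` columns. -/
def cost (p s t : ℕ) : ℚ := c p * s - t

/-- There is a deletion of rows and columns of `A` that leaves a simple matrix and has cost at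
least 1. -/
def HasDeletionOfCostAtLeastOne {ρ κ : Type*} (p : ℕ) (A : BinMatrix ρ κ) : Prop :=
  ∃ (S : Finset ρ) (T : Finset κ), IsSimple (deleteRowsCols A S T) ∧ 1 ≤ cost p S.card T.card

end ForbConfig

/-! Read the columns as a family `F` of subsets of the row set `V`. Call rows comparable if one is
contained in the other; avoidance bounds each separation count of an incomparable pair by `p - 1`,
so the undirected edges are exactly the incomparable pairs. If incomparability has no induced path
on three vertices, the components are cliques. Otherwise the claim is `|F| ≤ c_p |V|`, and then
removing all rows and all columns but one costs at least 1.

Both bounds are proved together in `card_le_of_sepBounded`, by induction on `V`. Deleting the rows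
`Q` loses at most `|mixed F Q| + |doubled F Q|` columns (`card_le_deletion_add`). Without an induced
path, take for `Q` a clique component: its doubled set has at most one element, and its mixed
columns are determined by their trace on it, so `card_add_one_le_c_mul` counts them.

With an induced path there are comparable rows `i ≤ k` with a common incomparable neighbour. Let `J`
be a maximal clique of such neighbours. In a counterexample, deleting `J ∪ {i, k}`, `{i, k}`, `{i}`
or `{k}` must each be too expensive. Double counting over `J` makes these demands contradictory
(`path_arithmetic`), except for `p = 8`, `|J| = 2`. There neither single-row deletion keeps an
induced path, so traces on `J` determine the relevant columns and there are too few of them. -/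

namespace ForbConfig

/-! ### Separation of rows and the loss caused by deleting rows -/

variable {α : Type*} [DecidableEq α]

/-- The columns, given as sets of rows, that have a `0` in row `u` and a `1` in row `v`. -/
def sep (F : Finset (Finset α)) (u v : α) : Finset (Finset α) :=
  F.filter fun x => u ∉ x ∧ v ∈ x

/-- Neither of the rows `u`, `v` contains the other. -/
def Incomp (F : Finset (Finset α)) (u v : α) : Prop :=
  (sep F u v).Nonempty ∧ (sep F v u).Nonempty

/-- The family of columns avoids `F(0,q+1,1,0)`. -/
def SepBounded (q : ℕ) (F : Finset (Finset α)) : Prop :=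
  ∀ u v, (sep F u v).Nonempty → (sep F v u).card ≤ q

/-- Delete the rows in `Q` and merge the columns that become equal. -/
def deletion (F : Finset (Finset α)) (Q : Finset α) : Finset (Finset α) :=
  F.image (· \ Q)

/-- The columns that are not constant on `Q`. -/
def mixed (F : Finset (Finset α)) (Q : Finset α) : Finset (Finset α) :=
  F.filter fun x => ¬ Disjoint x Q ∧ ¬ Q ⊆ x

/-- The columns that vanish on `Q` and stay columns when their entries on `Q` are changed to `1`. -/
def doubled (F : Finset (Finset α)) (Q : Finset α) : Finset (Finset α) :=
  F.filter fun y => Disjoint y Q ∧ y ∪ Q ∈ F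

/-- The graph of incomparable rows has an induced path on three vertices. -/
def HasInducedPath (F : Finset (Finset α)) : Prop :=
  ∃ a b e, Incomp F a b ∧ Incomp F b e ∧ a ≠ e ∧ ¬ Incomp F a e

variable {F : Finset (Finset α)} {Q : Finset α} {u v : α} {q : ℕ}

theorem mem_sep {x : Finset α} : x ∈ sep F u v ↔ x ∈ F ∧ u ∉ x ∧ v ∈ x := Finset.mem_filter

theorem mem_mixed {x : Finset α} : x ∈ mixed F Q ↔ x ∈ F ∧ ¬ Disjoint x Q ∧ ¬ Q ⊆ x :=
  Finset.mem_filter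

theorem mem_doubled {x : Finset α} : x ∈ doubled F Q ↔ x ∈ F ∧ Disjoint x Q ∧ x ∪ Q ∈ F :=
  Finset.mem_filter

theorem Incomp.symm (h : Incomp F u v) : Incomp F v u := ⟨h.2, h.1⟩

theorem Incomp.ne (h : Incomp F u v) : u ≠ v := by
  rintro rfl
  obtain ⟨x, hx⟩ := h.1
  rw [mem_sep] at hx
  exact hx.2.1 hx.2.2

theorem Incomp.card_sep_le (h : Incomp F u v) (hF : SepBounded q F) : (sep F u v).card ≤ q :=
  hF _ _ h.2

/-- Row `u` is contained in row `v`. -/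
def RowLE {β : Type*} (F : Finset (Finset β)) (u v : β) : Prop :=
  ∀ x ∈ F, u ∈ x → v ∈ x

theorem not_sep_nonempty_iff : ¬ (sep F u v).Nonempty ↔ RowLE F v u := by
  rw [Finset.not_nonempty_iff_eq_empty, sep, Finset.filter_eq_empty_iff, RowLE]
  refine forall₂_congr fun x _ => ?_
  tauto

theorem rowLE_or_rowLE_of_not_incomp (h : ¬ Incomp F u v) : RowLE F u v ∨ RowLE F v u := by
  rw [Incomp, not_and_or, not_sep_nonempty_iff, not_sep_nonempty_iff] at h
  exact h.symm

theorem Incomp.not_rowLE (h : Incomp F u v) : ¬ RowLE F u v := fun h' =>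
  not_sep_nonempty_iff.2 h' h.2

theorem incomp_of_not_rowLE (h₁ : ¬ RowLE F u v) (h₂ : ¬ RowLE F v u) : Incomp F u v := by
  by_contra h
  exact (rowLE_or_rowLE_of_not_incomp h).elim h₁ h₂

theorem RowLE.trans {β : Type*} {F : Finset (Finset β)} {u v w : β} (h₁ : RowLE F u v) (h₂ : RowLE F v w) : RowLE F u w :=
  fun x hx hu => h₂ x hx (h₁ x hx hu)

theorem Incomp.mem {V : Finset α} (h : Incomp F u v) (hV : ∀ x ∈ F, x ⊆ V) : u ∈ V := by
  obtain ⟨x, hx⟩ := h.2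
  rw [mem_sep] at hx
  exact hV x hx.1 hx.2.2

theorem sep_deletion (hu : u ∉ Q) (hv : v ∉ Q) :
    sep (deletion F Q) u v = (sep F u v).image (· \ Q) := by
  ext y
  simp only [mem_sep, deletion, Finset.mem_image]
  constructor
  · rintro ⟨⟨x, hx, rfl⟩, h₁, h₂⟩
    rw [Finset.mem_sdiff] at h₁ h₂
    exact ⟨x, ⟨hx, fun h => h₁ ⟨h, hu⟩, h₂.1⟩, rfl⟩
  · rintro ⟨x, ⟨hx, h₁, h₂⟩, rfl⟩
    exact ⟨⟨x, hx, rfl⟩, fun h => h₁ (Finset.mem_sdiff.1 h).1, Finset.mem_sdiff.2 ⟨h₂, hv⟩⟩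

theorem incomp_deletion (hu : u ∉ Q) (hv : v ∉ Q) :
    Incomp (deletion F Q) u v ↔ Incomp F u v := by
  rw [Incomp, sep_deletion hu hv, sep_deletion hv hu, Finset.image_nonempty, Finset.image_nonempty,
    Incomp]

theorem SepBounded.deletion (hF : SepBounded q F) (Q : Finset α) :
    SepBounded q (deletion F Q) := by
  -- The ground type does not change, so a deleted row survives as a zero row, which separates
  -- nothing.
  have key : ∀ u ∈ Q, ∀ v, sep (ForbConfig.deletion F Q) v u = ∅ := by
    intro u hu v
    refine Finset.filter_eq_empty_iff.2 fun y hy h => ?_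
    obtain ⟨x, -, rfl⟩ := Finset.mem_image.1 hy
    exact (Finset.mem_sdiff.1 h.2).2 hu
  intro u v h
  by_cases hu : u ∈ Q
  · simp [key u hu v]
  by_cases hv : v ∈ Q
  · simp [key v hv u] at h
  rw [sep_deletion hu hv, Finset.image_nonempty] at h
  rw [sep_deletion hv hu]
  exact Finset.card_image_le.trans (hF u v h)

/-- Deleting `Q` is injective on the columns that are 0 on `Q`, and on those that are 1 on `Q`. A
column of the first kind merges with one of the second only if it is doubled. -/
theorem card_le_deletion_add (F : Finset (Finset α)) (Q : Finset α) :
    F.card ≤ (deletion F Q).card + (mixed F Q).card + (doubled F Q).card := by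
  set A := F.filter fun x => Disjoint x Q with hA
  set B := F.filter fun x => Q ⊆ x with hB
  have hcover : F ⊆ mixed F Q ∪ (A ∪ B) := by
    intro x hx
    simp only [hA, hB, mixed, Finset.mem_union, Finset.mem_filter, hx, true_and]
    tauto
  have hAcard : (A.image (· \ Q)).card = A.card := by
    refine Finset.card_image_of_injOn fun x hx y hy h => ?_
    have hx' := (Finset.mem_filter.1 (Finset.mem_coe.1 hx)).2
    have hy' := (Finset.mem_filter.1 (Finset.mem_coe.1 hy)).2
    simpa [Finset.sdiff_eq_self_of_disjoint hx', Finset.sdiff_eq_self_of_disjoint hy'] using h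
  have hBcard : (B.image (· \ Q)).card = B.card := by
    refine Finset.card_image_of_injOn fun x hx y hy h => ?_
    have hx' := (Finset.mem_filter.1 (Finset.mem_coe.1 hx)).2
    have hy' := (Finset.mem_filter.1 (Finset.mem_coe.1 hy)).2
    have h' : x \ Q = y \ Q := h
    rw [← Finset.sdiff_union_of_subset hx', h', Finset.sdiff_union_of_subset hy']
  have hinter : A.image (· \ Q) ∩ B.image (· \ Q) ⊆ doubled F Q := by
    intro y hy
    obtain ⟨⟨a, ha, rfl⟩, b, hb, hab⟩ := by simpa only [Finset.mem_inter, Finset.mem_image] using hy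
    obtain ⟨ha, ha'⟩ := Finset.mem_filter.1 ha
    obtain ⟨hb, hb'⟩ := Finset.mem_filter.1 hb
    have hab' : a \ Q ∪ Q = b := by rw [← hab, Finset.sdiff_union_of_subset hb']
    refine mem_doubled.2 ⟨?_, Finset.sdiff_disjoint, hab' ▸ hb⟩
    rwa [Finset.sdiff_eq_self_of_disjoint ha']
  have hunion : A.image (· \ Q) ∪ B.image (· \ Q) ⊆ deletion F Q :=
    Finset.union_subset (Finset.image_subset_image (Finset.filter_subset _ _))
      (Finset.image_subset_image (Finset.filter_subset _ _))
  have h₁ := Finset.card_union_add_card_inter (A.image (· \ Q)) (B.image (· \ Q))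
  have h₂ := Finset.card_le_card hinter
  have h₃ := Finset.card_le_card hunion
  have h₄ := Finset.card_le_card hcover
  have h₅ := Finset.card_union_le (mixed F Q) (A ∪ B)
  have h₆ := Finset.card_union_le A B
  omega

/-- If `y`, `z` are doubled and `l ∈ y \ z`, then `y` refutes `l ≤ v` and `z ∪ Q` refutes `v ≤ l`
for every `v ∈ Q`, so `l` would be incomparable to all of `Q`. -/
theorem card_doubled_le_one (hQ : ∀ l, (∃ x ∈ F, l ∈ x) → l ∉ Q → ∃ v ∈ Q, ¬ Incomp F l v) :
    (doubled F Q).card ≤ 1 := by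
  have key : ∀ y ∈ doubled F Q, ∀ z ∈ doubled F Q, y ⊆ z := by
    intro y hy z hz l hl
    by_contra hlz
    obtain ⟨hyF, hyQ, hyQ'⟩ := mem_doubled.1 hy
    obtain ⟨hzF, hzQ, hzQ'⟩ := mem_doubled.1 hz
    have hlQ : l ∉ Q := fun h => Finset.disjoint_left.1 hyQ hl h
    obtain ⟨v, hv, hlv⟩ := hQ l ⟨y, hyF, hl⟩ hlQ
    rcases rowLE_or_rowLE_of_not_incomp hlv with h | h
    · exact Finset.disjoint_left.1 hyQ (h y hyF hl) hv
    · rcases Finset.mem_union.1 (h _ hzQ' (Finset.mem_union_right _ hv)) with h | h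
      · exact hlz h
      · exact hlQ h
  exact Finset.card_le_one.2 fun y hy z hz => (key y hy z hz).antisymm (key z hz y hy)

theorem deletion_subset {V : Finset α} (hV : ∀ x ∈ F, x ⊆ V) : ∀ y ∈ deletion F Q, y ⊆ V \ Q := by
  intro y hy
  obtain ⟨x, hx, rfl⟩ := Finset.mem_image.1 hy
  exact Finset.sdiff_subset_sdiff (hV x hx) subset_rfl

/-- Double counting of the pairs of rows of a clique that a column separates. -/
theorem sum_card_mul_le {J : Finset α} (hJ : ∀ u ∈ J, ∀ v ∈ J, u ≠ v → (sep F u v).card ≤ q) :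
    ∑ x ∈ F, (J \ x).card * (J ∩ x).card ≤ J.card * (J.card - 1) * q := by
  have h₁ : ∀ x ∈ F, (J \ x).card * (J ∩ x).card =
      ∑ e ∈ J.offDiag, if e.1 ∉ x ∧ e.2 ∈ x then 1 else 0 := by
    intro x _
    rw [← Finset.card_product, Finset.sum_boole, Nat.cast_id]
    congr 1
    ext ⟨a, b⟩
    simp only [Finset.mem_product, Finset.mem_sdiff, Finset.mem_inter, Finset.mem_filter,
      Finset.mem_offDiag]
    constructor
    · rintro ⟨⟨h₁, h₂⟩, h₃, h₄⟩
      exact ⟨⟨h₁, h₃, fun h => h₂ (h ▸ h₄)⟩, h₂, h₄⟩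
    · rintro ⟨⟨h₁, h₂, -⟩, h₃, h₄⟩
      exact ⟨⟨h₁, h₃⟩, h₂, h₄⟩
  rw [Finset.sum_congr rfl h₁, Finset.sum_comm]
  refine (Finset.sum_le_card_nsmul _ _ q fun e he => ?_).trans_eq ?_
  · rw [Finset.sum_boole, Nat.cast_id]
    obtain ⟨h₁, h₂, h₃⟩ := Finset.mem_offDiag.1 he
    exact hJ _ h₁ _ h₂ h₃
  · rw [Finset.offDiag_card, smul_eq_mul, Nat.mul_sub, mul_one]

/-- A column with `a` ones and `b` zeros on `J`, both positive, separates `ab ≥ a + b - 1 = |J| - 1`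
ordered pairs. -/
theorem card_mixed_le {J : Finset α} (hJ : ∀ u ∈ J, ∀ v ∈ J, u ≠ v → (sep F u v).card ≤ q) :
    (mixed F J).card ≤ J.card * q := by
  have h := sum_card_mul_le hJ
  have h₂ : (mixed F J).card * (J.card - 1) ≤ ∑ x ∈ F, (J \ x).card * (J ∩ x).card := by
    rw [← smul_eq_mul]
    refine (Finset.card_nsmul_le_sum _ _ _ fun x hx => ?_).trans
      (Finset.sum_le_sum_of_subset (Finset.filter_subset _ _))
    obtain ⟨-, h₁, h₂⟩ := mem_mixed.1 hx
    have h₃ := Finset.card_sdiff_add_card_inter J x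
    have h₄ : 0 < (J ∩ x).card := by
      rw [Finset.card_pos, Finset.inter_comm]
      exact Finset.not_disjoint_iff_nonempty_inter.1 h₁
    have h₅ : 0 < (J \ x).card := by
      rwa [Finset.card_pos, Finset.sdiff_nonempty]
    obtain ⟨a, ha⟩ := Nat.exists_eq_add_of_lt h₄
    obtain ⟨b, hb⟩ := Nat.exists_eq_add_of_lt h₅
    rw [← h₃, ha, hb]
    simp only [zero_add, Nat.add_sub_cancel, ← add_assoc]
    nlinarith [Nat.zero_le (a * b)]
  rcases Nat.lt_or_ge 1 J.card with h₃ | h₃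
  · refine Nat.le_of_mul_le_mul_right (c := J.card - 1) ?_ (by omega)
    calc _ ≤ _ := h₂.trans h
      _ = _ := by ring
  · have : mixed F J = ∅ := by
      refine Finset.filter_eq_empty_iff.2 fun x _ ⟨h₁, h₂⟩ => ?_
      obtain ⟨a, ha, ha'⟩ := Finset.not_disjoint_iff.1 h₁
      obtain ⟨b, hb, hb'⟩ := Finset.not_subset.1 h₂
      exact hb' (Finset.card_le_one.1 h₃ a ha' b hb ▸ ha)
    simp [this]

end ForbConfig

/-! ### Nonconstant columns on a clique of rows -/

namespace ForbConfig

variable {α : Type*} [DecidableEq α] {N : Finset (Finset α)} {K : Finset α} {q : ℕ}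

/-- The number of members of `N` of size `s` that contain `v`. -/
def degIn (N : Finset (Finset α)) (s : ℕ) (v : α) : ℕ := {x ∈ N | x.card = s ∧ v ∈ x}.card

/-- The number of members of `N` of size `s` that do not contain `v`. -/
def degOut (N : Finset (Finset α)) (s : ℕ) (v : α) : ℕ := {x ∈ N | x.card = s ∧ v ∉ x}.card

/-- The number of members of `N` of size `s`. -/
def levelCard {β : Type*} (N : Finset (Finset β)) (s : ℕ) : ℕ := {x ∈ N | x.card = s}.card

theorem degIn_add_degOut (N : Finset (Finset α)) (s : ℕ) (v : α) :
    degIn N s v + degOut N s v = levelCard N s := by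
  rw [degIn, degOut, levelCard, ← Finset.filter_filter, ← Finset.filter_filter,
    Finset.card_filter_add_card_filter_not]

theorem sum_degIn (hN : ∀ x ∈ N, x ⊆ K) (s : ℕ) :
    ∑ v ∈ K, degIn N s v = s * levelCard N s := by
  simp only [degIn, levelCard, ← Finset.filter_filter]
  refine (Finset.sum_card_bipartiteAbove_eq_sum_card_bipartiteBelow
    fun (v : α) (x : Finset α) => v ∈ x).trans ?_
  rw [Finset.sum_const_nat (m := s), mul_comm]
  intro x hx
  obtain ⟨hxN, rfl⟩ := Finset.mem_filter.1 hx
  congr 1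
  ext v
  simpa [Finset.bipartiteBelow] using fun h => hN x hxN h

theorem sum_degOut (hN : ∀ x ∈ N, x ⊆ K) (s : ℕ) :
    ∑ v ∈ K, degOut N s v + s * levelCard N s = K.card * levelCard N s := by
  rw [← sum_degIn hN s, ← Finset.sum_add_distrib, ← smul_eq_mul, ← Finset.sum_const]
  exact Finset.sum_congr rfl fun v _ => by rw [add_comm, degIn_add_degOut]

theorem degIn_one_le (N : Finset (Finset α)) (v : α) : degIn N 1 v ≤ 1 := by
  refine Finset.card_le_one.2 fun x hx y hy => ?_
  obtain ⟨-, hx, hvx⟩ := Finset.mem_filter.1 hx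
  obtain ⟨-, hy, hvy⟩ := Finset.mem_filter.1 hy
  obtain ⟨a, rfl⟩ := Finset.card_eq_one.1 hx
  obtain ⟨b, rfl⟩ := Finset.card_eq_one.1 hy
  rw [← Finset.mem_singleton.1 hvx, ← Finset.mem_singleton.1 hvy]

theorem degOut_le_one (hN : ∀ x ∈ N, x ⊆ K) {v : α} (hv : v ∈ K) :
    degOut N (K.card - 1) v ≤ 1 := by
  have key : ∀ x ∈ N, x.card = K.card - 1 → v ∉ x → x = K.erase v := fun x hx hc hvx =>
    Finset.eq_of_subset_of_card_le (Finset.subset_erase.2 ⟨hN x hx, hvx⟩)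
      (by rw [Finset.card_erase_of_mem hv, hc])
  refine Finset.card_le_one.2 fun x hx y hy => ?_
  obtain ⟨hxN, hx, hvx⟩ := Finset.mem_filter.1 hx
  obtain ⟨hyN, hy, hvy⟩ := Finset.mem_filter.1 hy
  rw [key x hxN hx hvx, key y hyN hy hvy]

theorem levelCard_le_choose {β : Type*} {N : Finset (Finset β)} {K : Finset β} (hN : ∀ x ∈ N, x ⊆ K) (s : ℕ) :
    levelCard N s ≤ K.card.choose s := by
  rw [← Finset.card_powersetCard]
  refine Finset.card_le_card fun x hx => ?_
  obtain ⟨hx, hs⟩ := Finset.mem_filter.1 hx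
  exact Finset.mem_powersetCard.2 ⟨hN x hx, hs⟩

theorem sum_le_add_of_le_one {f : α → ℕ} (hf : ∀ v ∈ K, f v ≤ 1) {v : α} (hv : v ∈ K) :
    ∑ u ∈ K, f u ≤ f v + (K.card - 1) := by
  rw [← Finset.add_sum_erase K f hv, ← Finset.card_erase_of_mem hv]
  gcongr
  simpa using Finset.sum_le_card_nsmul _ f 1 fun u hu => hf u (Finset.mem_of_mem_erase hu)

/-- Counts the pairs `(x, u)` with `v ∈ x`, `u ∉ x` in two ways. This local form of the double count
is needed where the global one is not sharp enough. -/
theorem sum_filter_mem_le (hN : ∀ x ∈ N, x ⊆ K)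
    (hK : ∀ u ∈ K, ∀ v ∈ K, u ≠ v → (sep N u v).card ≤ q) {v : α} (hv : v ∈ K) :
    ∑ x ∈ N with v ∈ x, (K.card - x.card) ≤ (K.card - 1) * q := by
  have h : ∑ x ∈ N with v ∈ x, (K.card - x.card) = ∑ u ∈ K.erase v, (sep N u v).card := by
    have := Finset.sum_card_bipartiteAbove_eq_sum_card_bipartiteBelow
      (s := N.filter (v ∈ ·)) (t := K.erase v) (fun (x : Finset α) (u : α) => u ∉ x)
    convert this using 2 with x hx u hu
    · obtain ⟨hx, hvx⟩ := Finset.mem_filter.1 hx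
      rw [← Finset.card_sdiff_of_subset (hN x hx)]
      congr 1
      ext u
      simp only [Finset.mem_sdiff, Finset.bipartiteAbove, Finset.mem_filter, Finset.mem_erase]
      exact ⟨fun h => ⟨⟨fun h' => h.2 (h' ▸ hvx), h.1⟩, h.2⟩, fun h => ⟨h.1.2, h.2⟩⟩
    · congr 1
      ext x
      simp only [mem_sep, Finset.bipartiteBelow, Finset.mem_filter]
      tauto
  rw [h, ← Finset.card_erase_of_mem hv, ← smul_eq_mul]
  refine Finset.sum_le_card_nsmul _ _ _ fun u hu => ?_
  exact hK u (Finset.mem_of_mem_erase hu) v hv (Finset.ne_of_mem_erase hu)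

theorem sum_filter_not_mem_le (hN : ∀ x ∈ N, x ⊆ K)
    (hK : ∀ u ∈ K, ∀ v ∈ K, u ≠ v → (sep N u v).card ≤ q) {v : α} (hv : v ∈ K) :
    ∑ x ∈ N with v ∉ x, x.card ≤ (K.card - 1) * q := by
  have h : ∑ x ∈ N with v ∉ x, x.card = ∑ u ∈ K.erase v, (sep N v u).card := by
    have := Finset.sum_card_bipartiteAbove_eq_sum_card_bipartiteBelow
      (s := N.filter (v ∉ ·)) (t := K.erase v) (fun (x : Finset α) (u : α) => u ∈ x)
    convert this using 2 with x hx u hu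
    · obtain ⟨hx, hvx⟩ := Finset.mem_filter.1 hx
      congr 1
      ext u
      simp only [Finset.bipartiteAbove, Finset.mem_filter, Finset.mem_erase]
      exact ⟨fun h => ⟨⟨fun h' => hvx (h' ▸ h), hN x hx h⟩, h⟩, fun h => h.2⟩
    · congr 1
      ext x
      simp only [mem_sep, Finset.bipartiteBelow, Finset.mem_filter]
      tauto
  rw [h, ← Finset.card_erase_of_mem hv, ← smul_eq_mul]
  refine Finset.sum_le_card_nsmul _ _ _ fun u hu => ?_
  exact hK v hv u (Finset.mem_of_mem_erase hu) (Finset.ne_of_mem_erase hu).symm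

theorem sum_range_degIn (f : ℕ → ℕ) {k : ℕ} (hN : ∀ x ∈ N, x.card < k) (v : α) :
    ∑ s ∈ Finset.range k, f s * degIn N s v = ∑ x ∈ N with v ∈ x, f x.card := by
  rw [← Finset.sum_fiberwise_of_maps_to (g := Finset.card) (t := Finset.range k)]
  · refine Finset.sum_congr rfl fun s _ => ?_
    rw [Finset.sum_congr rfl fun x hx => congrArg f (Finset.mem_filter.1 hx).2, Finset.sum_const,
      smul_eq_mul, mul_comm, Finset.filter_filter, degIn]
    simp only [and_comm]
  · exact fun x hx => Finset.mem_range.2 (hN x (Finset.mem_filter.1 hx).1)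

theorem sum_range_degOut (f : ℕ → ℕ) {k : ℕ} (hN : ∀ x ∈ N, x.card < k) (v : α) :
    ∑ s ∈ Finset.range k, f s * degOut N s v = ∑ x ∈ N with v ∉ x, f x.card := by
  rw [← Finset.sum_fiberwise_of_maps_to (g := Finset.card) (t := Finset.range k)]
  · refine Finset.sum_congr rfl fun s _ => ?_
    rw [Finset.sum_congr rfl fun x hx => congrArg f (Finset.mem_filter.1 hx).2, Finset.sum_const,
      smul_eq_mul, mul_comm, Finset.filter_filter, degOut]
    simp only [and_comm]
  · exact fun x hx => Finset.mem_range.2 (hN x (Finset.mem_filter.1 hx).1)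

theorem sum_range_levelCard {β : Type*} {N : Finset (Finset β)} {k : ℕ} (hN : ∀ x ∈ N, x.card < k) :
    ∑ s ∈ Finset.range k, levelCard N s = N.card :=
  (Finset.card_eq_sum_card_fiberwise fun x hx => Finset.mem_coe.2 (Finset.mem_range.2 (hN x hx))).symm

theorem levelCard_zero {β : Type*} {N : Finset (Finset β)} (h0 : ∀ x ∈ N, x.Nonempty) : levelCard N 0 = 0 := by
  rw [levelCard, Finset.card_eq_zero, Finset.filter_eq_empty_iff]
  intro x hx h
  exact (h0 x hx).card_pos.ne' h

theorem card_le_two_pow_sub_two (hK : K.Nonempty) (hN : ∀ x ∈ N, x ⊂ K) (h0 : ∀ x ∈ N, x.Nonempty) :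
    N.card ≤ 2 ^ K.card - 2 := by
  have h : N ⊆ (K.powerset.erase ∅).erase K := fun x hx => by
    simp only [Finset.mem_erase, Finset.mem_powerset]
    exact ⟨(hN x hx).ne, (h0 x hx).ne_empty, (hN x hx).subset⟩
  have := Finset.card_le_card h
  rwa [Finset.card_erase_of_mem, Finset.card_erase_of_mem (Finset.empty_mem_powerset K),
    Finset.card_powerset, Nat.sub_sub] at this
  simp [hK.ne_empty]

/-- Members of size `1` or `|K| - 1` separate `|K| - 1` pairs of rows, all others at least
`2 (|K| - 2)`. -/
theorem two_mul_card_le (hN : ∀ x ∈ N, x ⊂ K) (h0 : ∀ x ∈ N, x.Nonempty)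
    (hK : ∀ u ∈ K, ∀ v ∈ K, u ≠ v → (sep N u v).card ≤ q) :
    2 * (K.card - 2) * N.card ≤ K.card * (K.card - 1) * q +
      (K.card - 3) * (levelCard N 1 + levelCard N (K.card - 1)) := by
  have h := sum_card_mul_le hK
  have key : ∀ x ∈ N, 2 * (K.card - 2) ≤ (K \ x).card * (K ∩ x).card +
      (K.card - 3) * ((if x.card = 1 then 1 else 0) + if x.card = K.card - 1 then 1 else 0) := by
    intro x hx
    have h₁ := (h0 x hx).card_pos
    have h₂ := Finset.card_lt_card (hN x hx)
    rw [Finset.inter_eq_right.2 (hN x hx).subset, Finset.card_sdiff_of_subset (hN x hx).subset]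
    generalize x.card = a at *
    generalize K.card = k at *
    obtain ⟨b, rfl⟩ := Nat.exists_eq_add_of_lt h₂
    rw [show a + b + 1 - a = b + 1 by omega]
    by_cases ha : a = 1
    · subst ha
      rw [if_pos rfl, mul_add]
      have := Nat.zero_le ((1 + b + 1 - 3) * if 1 = 1 + b + 1 - 1 then 1 else 0)
      omega
    by_cases hb : b = 0
    · subst hb
      rw [if_pos (show a = a + 0 + 1 - 1 by omega), mul_add]
      have := Nat.zero_le ((a + 0 + 1 - 3) * if a = 1 then 1 else 0)
      omega
    refine le_add_right ?_
    obtain ⟨a', rfl⟩ : ∃ a', a = a' + 2 := ⟨a - 2, by omega⟩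
    obtain ⟨b', rfl⟩ : ∃ b', b = b' + 1 := ⟨b - 1, by omega⟩
    rw [show a' + 2 + (b' + 1) + 1 - 2 = a' + b' + 2 by omega]
    nlinarith [Nat.zero_le (a' * b')]
  have h₂ := Finset.sum_le_sum key
  rw [Finset.sum_const, smul_eq_mul, Finset.sum_add_distrib, ← Finset.mul_sum,
    Finset.sum_add_distrib, Finset.sum_boole, Finset.sum_boole, Nat.cast_id, Nat.cast_id,
    mul_comm] at h₂
  exact h₂.trans (Nat.add_le_add_right h _)

/-- With 11 members the global count forces all 4 singletons and all 4 triples to be present. The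
count at one row then leaves room for at most one pair through it, hence at most 2 pairs altogether.
-/
theorem card_le_ten (hk : K.card = 4) (hN : ∀ x ∈ N, x ⊂ K) (h0 : ∀ x ∈ N, x.Nonempty)
    (hK : ∀ u ∈ K, ∀ v ∈ K, u ≠ v → (sep N u v).card ≤ 3) : N.card ≤ 10 := by
  by_contra! hlt
  have hsub : ∀ x ∈ N, x ⊆ K := fun x hx => (hN x hx).subset
  have hcard : ∀ x ∈ N, x.card < 4 := fun x hx => hk ▸ Finset.card_lt_card (hN x hx)
  have h₁ := two_mul_card_le hN h0 hK
  have h₂ := sum_range_levelCard hcard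
  have h₃ := levelCard_le_choose hsub 1
  have h₄ := levelCard_le_choose hsub 3
  have h₅ := levelCard_zero h0
  rw [hk] at h₁ h₃ h₄
  simp only [Finset.sum_range_succ, Finset.sum_range_zero, h₅] at h₂
  norm_num [Nat.choose] at h₁ h₃ h₄
  have key : ∀ v ∈ K, degIn N 2 v ≤ 1 := by
    intro v hv
    have e₁ := sum_filter_mem_le hsub hK hv
    rw [hk, ← sum_range_degIn (fun s => 4 - s) hcard] at e₁
    simp only [Finset.sum_range_succ, Finset.sum_range_zero] at e₁
    have e₂ := sum_le_add_of_le_one (fun v _ => degIn_one_le N v) hv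
    rw [sum_degIn hsub, hk] at e₂
    have e₃ := degOut_le_one hsub hv
    have e₄ := degIn_add_degOut N 3 v
    rw [hk] at e₃
    norm_num at e₁ e₃
    omega
  have h₆ := Finset.sum_le_card_nsmul _ _ _ key
  rw [sum_degIn hsub, hk, smul_eq_mul] at h₆
  omega

/-- With 13 members at most one of the 10 sets of size 1 or 4 is missing. The local counts at every
row then contradict the degree sums over the 5 rows. -/
theorem card_le_twelve (hk : K.card = 5) (hN : ∀ x ∈ N, x ⊂ K) (h0 : ∀ x ∈ N, x.Nonempty)
    (hK : ∀ u ∈ K, ∀ v ∈ K, u ≠ v → (sep N u v).card ≤ 3) : N.card ≤ 12 := by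
  by_contra! hlt
  have hsub : ∀ x ∈ N, x ⊆ K := fun x hx => (hN x hx).subset
  have hcard : ∀ x ∈ N, x.card < 5 := fun x hx => hk ▸ Finset.card_lt_card (hN x hx)
  have h₁ := two_mul_card_le hN h0 hK
  have h₂ := sum_range_levelCard hcard
  have h₃ := levelCard_le_choose hsub 1
  have h₄ := levelCard_le_choose hsub 4
  have h₅ := levelCard_zero h0
  rw [hk] at h₁ h₃ h₄
  simp only [Finset.sum_range_succ, Finset.sum_range_zero, h₅] at h₂
  norm_num [Nat.choose] at h₁ h₃ h₄
  have key : ∀ v ∈ K,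
      4 * degIn N 1 v + 3 * degIn N 2 v + 2 * degIn N 3 v + degIn N 4 v ≤ 12 ∧
      degOut N 1 v + 2 * degOut N 2 v + 3 * degOut N 3 v + 4 * degOut N 4 v ≤ 12 ∧
      degIn N 1 v ≤ 1 ∧ degOut N 4 v ≤ 1 ∧ levelCard N 1 ≤ degIn N 1 v + 4 ∧
      levelCard N 4 ≤ degOut N 4 v + 4 ∧
      degIn N 1 v + degOut N 1 v = levelCard N 1 ∧ degIn N 2 v + degOut N 2 v = levelCard N 2 ∧
      degIn N 3 v + degOut N 3 v = levelCard N 3 ∧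
      degIn N 4 v + degOut N 4 v = levelCard N 4 := by
    intro v hv
    have e₀ : degIn N 0 v + degOut N 0 v = 0 := by rw [degIn_add_degOut, h₅]
    have e₁ := sum_filter_mem_le hsub hK hv
    rw [hk, ← sum_range_degIn (fun s => 5 - s) hcard] at e₁
    have e₂ := sum_filter_not_mem_le hsub hK hv
    rw [hk, ← sum_range_degOut (fun s => s) hcard] at e₂
    simp only [Finset.sum_range_succ, Finset.sum_range_zero] at e₁ e₂
    have e₃ := degOut_le_one hsub hv
    have e₄ := sum_le_add_of_le_one (fun v _ => degIn_one_le N v) hv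
    have e₅ := sum_le_add_of_le_one (fun v hv => degOut_le_one hsub hv) hv
    have e₆ := sum_degOut hsub 4
    rw [sum_degIn hsub, hk] at e₄
    rw [hk] at e₃ e₅ e₆
    norm_num at e₁ e₂ e₃ e₅
    exact ⟨by omega, by omega, degIn_one_le N v, e₃, by omega, by omega, degIn_add_degOut N 1 v,
      degIn_add_degOut N 2 v, degIn_add_degOut N 3 v, degIn_add_degOut N 4 v⟩
  have s₁ := sum_degIn hsub 1
  have s₂ := sum_degIn hsub 2
  have s₃ := sum_degIn hsub 3
  have t₃ := sum_degOut hsub 3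
  have t₄ := sum_degOut hsub 4
  rw [hk] at t₃ t₄
  obtain ⟨v₀, hv₀⟩ : K.Nonempty := Finset.card_pos.1 (by omega)
  rcases (show levelCard N 1 = 5 ∧ levelCard N 4 = 5 ∨ levelCard N 1 = 4 ∧ levelCard N 4 = 5 ∨
    levelCard N 1 = 5 ∧ levelCard N 4 = 4 by omega) with ⟨l₁, l₄⟩ | ⟨l₁, l₄⟩ | ⟨l₁, l₄⟩
  · have l : levelCard N 2 + levelCard N 3 = 3 := by omega
    -- In each case the local bounds make some degree constant on the 5 rows, and its sum is not the
    -- required multiple of the level size.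
    rcases (show levelCard N 3 = 0 ∨ levelCard N 3 = 1 ∨ 2 ≤ levelCard N 3 by omega) with
      l₃ | l₃ | l₃
    · have : ∀ v ∈ K, degIn N 2 v = 1 := fun v hv => by have := key v hv; omega
      rw [Finset.sum_congr rfl this, Finset.sum_const, smul_eq_mul, hk] at s₂
      omega
    · have : ∀ v ∈ K, degIn N 2 v = 0 := fun v hv => by have := key v hv; omega
      rw [Finset.sum_congr rfl this, Finset.sum_const, smul_eq_mul, hk] at s₂
      omega
    · have : ∀ v ∈ K, degIn N 3 v = 2 := fun v hv => by have := key v hv; omega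
      rw [Finset.sum_congr rfl this, Finset.sum_const, smul_eq_mul, hk] at s₃
      omega
  · have l : levelCard N 2 + levelCard N 3 = 4 := by omega
    -- A row whose singleton is present lies in no pair of `N`. Summation gives `2 l₂ + 4 l₂ ≤ 5
    -- l₂`, so there are no pairs, whereas a present singleton requires one. The remaining case is
    -- the complementary one.
    have h : ∀ v ∈ K, degIn N 2 v + degIn N 1 v * levelCard N 2 ≤ levelCard N 2 ∧
        degIn N 1 v ≤ levelCard N 2 := by
      intro v hv
      have := key v hv
      rcases (show degIn N 1 v = 0 ∨ degIn N 1 v = 1 by omega) with h | h <;> rw [h] <;> omega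
    have h' := Finset.sum_le_card_nsmul _ _ _ fun v hv => (h v hv).1
    rw [Finset.sum_add_distrib, ← Finset.sum_mul, s₁, s₂, l₁, hk, smul_eq_mul] at h'
    have h'' : ∀ v ∈ K, degIn N 1 v = 0 := fun v hv => by
      have := (h v hv).2
      omega
    rw [Finset.sum_congr rfl h'', Finset.sum_const_zero] at s₁
    omega
  · have l : levelCard N 2 + levelCard N 3 = 4 := by omega
    have h : ∀ v ∈ K, degOut N 3 v + degOut N 4 v * levelCard N 3 ≤ levelCard N 3 ∧
        degOut N 4 v ≤ levelCard N 3 := by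
      intro v hv
      have := key v hv
      rcases (show degOut N 4 v = 0 ∨ degOut N 4 v = 1 by omega) with h | h <;> rw [h] <;> omega
    have h' := Finset.sum_le_card_nsmul _ _ _ fun v hv => (h v hv).1
    rw [Finset.sum_add_distrib, ← Finset.sum_mul, hk, smul_eq_mul] at h'
    have t₄' : ∑ v ∈ K, degOut N 4 v = 4 := by omega
    rw [t₄'] at h'
    have h'' : ∀ v ∈ K, degOut N 4 v = 0 := fun v hv => by
      have := (h v hv).2
      omega
    rw [Finset.sum_congr rfl h'', Finset.sum_const_zero] at t₄'
    omega

/-- A clique of `k` rows has at most `c_p k - 1` nonconstant columns. -/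
theorem card_add_one_le_c_mul {p : ℕ} (hp3 : 3 ≤ p) (hp9 : p ≤ 9) (hne : K.Nonempty)
    (hN : ∀ x ∈ N, x ⊂ K) (h0 : ∀ x ∈ N, x.Nonempty)
    (hK : ∀ u ∈ K, ∀ v ∈ K, u ≠ v → (sep N u v).card ≤ p - 1) :
    (N.card : ℚ) + 1 ≤ c p * K.card := by
  have hsub : ∀ x ∈ N, x ⊆ K := fun x hx => (hN x hx).subset
  have hpow := card_le_two_pow_sub_two hne hN h0
  have hmul := two_mul_card_le hN h0 hK
  have hl₁ := levelCard_le_choose hsub 1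
  have hl₂ := levelCard_le_choose hsub (K.card - 1)
  have hpos : 0 < K.card := hne.card_pos
  rw [Nat.choose_one_right] at hl₁
  rw [Nat.choose_symm (show 1 ≤ K.card by omega), Nat.choose_one_right] at hl₂
  -- Here the general bounds give only 11 and 13, while `c_4 = 11/4` needs 10 and 12.
  have h4 : p = 4 → K.card = 4 → N.card ≤ 10 := by rintro rfl hk; exact card_le_ten hk hN h0 hK
  have h5 : p = 4 → K.card = 5 → N.card ≤ 12 := by rintro rfl hk; exact card_le_twelve hk hN h0 hK
  have hmul : 2 * (K.card - 2) * N.card ≤ K.card * (K.card - 1) * (p - 1) +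
      (K.card - 3) * (2 * K.card) := hmul.trans (by gcongr; omega)
  clear hK hN h0 hsub hl₁ hl₂ hne
  generalize K.card = k at *
  generalize N.card = n at *
  -- Up to 6 rows, integrality is needed; from 7 rows on, the double count alone suffices over the
  -- rationals.
  rcases Nat.lt_or_ge k 7 with hk | hk
  · have key : ∀ a b : ℕ, 0 < b → b * (n + 1) ≤ a * k → (n : ℚ) + 1 ≤ (a / b : ℚ) * k := by
      intro a b hb h
      rw [div_mul_eq_mul_div, le_div_iff₀ (by exact_mod_cast hb), mul_comm]
      exact_mod_cast h
    interval_cases p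
    · exact_mod_cast key 7 3 (by norm_num) (by interval_cases k <;> omega)
    · exact_mod_cast key 11 4 (by norm_num) (by interval_cases k <;> omega)
    · exact_mod_cast key 15 4 (by norm_num) (by interval_cases k <;> omega)
    · exact_mod_cast key 21 5 (by norm_num) (by interval_cases k <;> omega)
    · exact_mod_cast key 24 5 (by norm_num) (by interval_cases k <;> omega)
    · exact_mod_cast key 27 5 (by norm_num) (by interval_cases k <;> omega)
    · exact_mod_cast key 31 5 (by norm_num) (by interval_cases k <;> omega)
  · obtain ⟨t, rfl⟩ := Nat.exists_eq_add_of_le hk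
    rw [show 7 + t - 2 = t + 5 by omega, show 7 + t - 1 = t + 6 by omega,
      show 7 + t - 3 = t + 4 by omega] at hmul
    have hmul' : (2 * (t + 5) * n : ℚ) ≤ (7 + t) * (t + 6) * ((p - 1 : ℕ) : ℚ) +
      (t + 4) * (2 * (7 + t)) := by exact_mod_cast hmul
    have ht : (0 : ℚ) ≤ t := t.cast_nonneg
    have hpos' : (0 : ℚ) < 2 * (t + 5) := by positivity
    refine le_of_mul_le_mul_left ?_ hpos'
    push_cast
    interval_cases p <;> norm_num [c] at hmul' ⊢ <;> nlinarith [mul_nonneg ht ht]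

end ForbConfig

/-! ### Column counts for two comparable rows and a clique `J` -/

namespace ForbConfig

variable {α : Type*} [DecidableEq α] {F : Finset (Finset α)} {J : Finset α} {i k : α} {q : ℕ}

/-- The columns with a `1` in row `i` that are not constantly `1` on `J`. -/
def upperCols (F : Finset (Finset α)) (i : α) (J : Finset α) : Finset (Finset α) :=
  {x ∈ F | i ∈ x ∧ ¬ J ⊆ x}

/-- The columns with a `0` in row `k` that are not constantly `0` on `J`. -/
def lowerCols (F : Finset (Finset α)) (k : α) (J : Finset α) : Finset (Finset α) :=
  {x ∈ F | k ∉ x ∧ ¬ Disjoint x J}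

/-- The columns with a `1` in row `i` that vanish on `J`. -/
def upperAntiCols (F : Finset (Finset α)) (i : α) (J : Finset α) : Finset (Finset α) :=
  {x ∈ F | i ∈ x ∧ Disjoint x J}

/-- The columns with a `0` in row `k` that are constantly `1` on `J`. -/
def lowerAntiCols (F : Finset (Finset α)) (k : α) (J : Finset α) : Finset (Finset α) :=
  {x ∈ F | k ∉ x ∧ J ⊆ x}

theorem card_mixed_insert_le (hik : RowLE F i k) :
    (mixed F (insert i (insert k J))).card ≤
      (sep F i k).card + ((upperCols F i J).card + (lowerCols F k J).card) := by
  have h : mixed F (insert i (insert k J)) ⊆ sep F i k ∪ (upperCols F i J ∪ lowerCols F k J) := by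
    intro x hx
    obtain ⟨hxF, h₁, h₂⟩ := mem_mixed.1 hx
    simp only [Finset.disjoint_insert_right, Finset.insert_subset_iff] at h₁ h₂
    simp only [Finset.mem_union, mem_sep, upperCols, lowerCols, Finset.mem_filter, hxF, true_and]
    have := hik x hxF
    tauto
  exact (Finset.card_le_card h).trans ((Finset.card_union_le _ _).trans
    (Nat.add_le_add_left (Finset.card_union_le _ _) _))

theorem card_mixed_pair (hik : RowLE F i k) : (mixed F {i, k}).card ≤ (sep F i k).card := by
  refine Finset.card_le_card fun x hx => ?_
  obtain ⟨hxF, h₁, h₂⟩ := mem_mixed.1 hx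
  simp only [Finset.disjoint_insert_right, Finset.insert_subset_iff, Finset.disjoint_singleton_right,
    Finset.singleton_subset_iff] at h₁ h₂
  have := hik x hxF
  exact mem_sep.2 ⟨hxF, by tauto⟩

theorem mixed_singleton (F : Finset (Finset α)) (v : α) : mixed F {v} = ∅ := by
  refine Finset.filter_eq_empty_iff.2 fun x _ h => ?_
  simp only [Finset.disjoint_singleton_right, Finset.singleton_subset_iff] at h
  exact h.1 h.2

/-- As `i ≤ k`, the three sets on the left are disjoint and each of their columns separates `i` from
`j` or `j` from `k` in the direction counted by the hypotheses, never both. -/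
theorem card_off_add_le {j : α} (hik : RowLE F i k) (h₁ : (sep F i j).card ≤ q)
    (h₂ : (sep F j k).card ≤ q) :
    {x ∈ F | i ∈ x ∧ j ∉ x}.card + {x ∈ F | k ∉ x ∧ j ∈ x}.card + (sep F i k).card ≤ 2 * q := by
  have h : {x ∈ F | i ∈ x ∧ j ∉ x}.card + {x ∈ F | k ∉ x ∧ j ∈ x}.card + (sep F i k).card ≤
      (sep F i j).card + (sep F j k).card := by
    simp only [sep, Finset.card_filter, ← Finset.sum_add_distrib]
    refine Finset.sum_le_sum fun x hx => ?_
    have := hik x hx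
    by_cases hi : i ∈ x <;> by_cases hk : k ∈ x <;> by_cases hj : j ∈ x <;> simp_all
  omega

theorem sum_off_add_le (hik : RowLE F i k)
    (hJ : ∀ j ∈ J, (sep F i j).card ≤ q ∧ (sep F j k).card ≤ q) :
    ∑ x ∈ F with i ∈ x, (J \ x).card + ∑ x ∈ F with k ∉ x, (J ∩ x).card +
      J.card * (sep F i k).card ≤ J.card * (2 * q) := by
  have h₁ : ∑ x ∈ F with i ∈ x, (J \ x).card = ∑ j ∈ J, {x ∈ F | i ∈ x ∧ j ∉ x}.card := by
    simp only [← Finset.filter_filter]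
    refine Eq.trans ?_ (Finset.sum_card_bipartiteAbove_eq_sum_card_bipartiteBelow
      (s := F.filter (i ∈ ·)) (t := J) fun (x : Finset α) (j : α) => j ∉ x)
    refine Finset.sum_congr rfl fun x _ => congrArg _ ?_
    ext; simp [Finset.bipartiteAbove]
  have h₂ : ∑ x ∈ F with k ∉ x, (J ∩ x).card = ∑ j ∈ J, {x ∈ F | k ∉ x ∧ j ∈ x}.card := by
    simp only [← Finset.filter_filter]
    refine Eq.trans ?_ (Finset.sum_card_bipartiteAbove_eq_sum_card_bipartiteBelow
      (s := F.filter (k ∉ ·)) (t := J) fun (x : Finset α) (j : α) => j ∈ x)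
    refine Finset.sum_congr rfl fun x _ => congrArg _ ?_
    ext; simp [Finset.bipartiteAbove]
  rw [h₁, h₂, ← Finset.sum_add_distrib, ← smul_eq_mul J.card, ← Finset.sum_const,
    ← Finset.sum_add_distrib, ← smul_eq_mul, ← Finset.sum_const]
  exact Finset.sum_le_sum fun j hj => card_off_add_le hik (hJ j hj).1 (hJ j hj).2

/-- The excess of a column that differs in `a` of `r` rows from the column it is compared to. -/
def excess (r a : ℕ) : ℕ := a - 1 - if a = r then 1 else 0

theorem excess_add {r a : ℕ} (hr : 2 ≤ r) :
    excess r a + ((if a = 0 then 0 else 1) + if a = r then 1 else 0) = a := by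
  unfold excess
  split_ifs <;> omega

theorem excess_add_excess {r a b : ℕ} (hr : 2 ≤ r) (h : a + b = r) :
    excess r a + excess r b = r - 2 := by
  unfold excess
  split_ifs <;> omega

/-- Splits the number of deviations of a column into 1 if it deviates at all, 1 more if it deviates
on all of `J`, and the excess. -/
theorem card_upperCols_add (hJ : 2 ≤ J.card) :
    ∑ x ∈ F with i ∈ x, (J \ x).card = ∑ x ∈ F with i ∈ x, excess J.card (J \ x).card +
      ((upperCols F i J).card + (upperAntiCols F i J).card) := by
  rw [upperCols, upperAntiCols, ← Finset.filter_filter, ← Finset.filter_filter, Finset.card_filter,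
    Finset.card_filter, ← Finset.sum_add_distrib, ← Finset.sum_add_distrib]
  refine Finset.sum_congr rfl fun x _ => ?_
  conv_lhs => rw [← excess_add hJ (a := (J \ x).card)]
  congr 2
  · by_cases h : J ⊆ x <;> simp [h, Finset.sdiff_eq_empty_iff_subset]
  · congr 1
    rw [← Finset.card_sdiff_add_card_inter J x, eq_iff_iff, left_eq_add, Finset.card_eq_zero,
      ← Finset.disjoint_iff_inter_eq_empty, disjoint_comm]

theorem card_lowerCols_add (hJ : 2 ≤ J.card) :
    ∑ x ∈ F with k ∉ x, (J ∩ x).card = ∑ x ∈ F with k ∉ x, excess J.card (J ∩ x).card +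
      ((lowerCols F k J).card + (lowerAntiCols F k J).card) := by
  rw [lowerCols, lowerAntiCols, ← Finset.filter_filter, ← Finset.filter_filter, Finset.card_filter,
    Finset.card_filter, ← Finset.sum_add_distrib, ← Finset.sum_add_distrib]
  refine Finset.sum_congr rfl fun x _ => ?_
  conv_lhs => rw [← excess_add hJ (a := (J ∩ x).card)]
  congr 2
  · by_cases h : Disjoint x J <;>
      simp [h, ← Finset.disjoint_iff_inter_eq_empty, disjoint_comm (a := J)]
  · congr 1
    rw [← Finset.card_sdiff_add_card_inter J x, eq_iff_iff, right_eq_add, Finset.card_eq_zero,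
      Finset.sdiff_eq_empty_iff_subset]

/-- A doubled `y` contributes through `y ∪ {i, k}` to the first sum and through `y` to the second.
Their deviations add up to `|J|`, so their excesses add up to `|J| - 2`. -/
theorem mul_card_doubled_le (hJ : 2 ≤ J.card) (hi : i ∉ J) (hk : k ∉ J) :
    (J.card - 2) * (doubled F {i, k}).card ≤
      ∑ x ∈ F with i ∈ x, excess J.card (J \ x).card +
      ∑ x ∈ F with k ∉ x, excess J.card (J ∩ x).card := by
  have hd : ∀ y ∈ doubled F {i, k}, y ∈ F ∧ i ∉ y ∧ k ∉ y ∧ y ∪ {i, k} ∈ F := by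
    intro y hy
    simpa [Finset.disjoint_insert_right, and_assoc] using mem_doubled.1 hy
  have h₁ : ∑ y ∈ doubled F {i, k}, excess J.card (J \ y).card ≤
      ∑ x ∈ F with i ∈ x, excess J.card (J \ x).card := by
    have hinj : Set.InjOn (· ∪ {i, k}) (doubled F {i, k} : Set (Finset α)) := by
      intro y hy z hz h
      have hy' := (mem_doubled.1 (Finset.mem_coe.1 hy)).2.1
      have hz' := (mem_doubled.1 (Finset.mem_coe.1 hz)).2.1
      have h' : y ∪ {i, k} = z ∪ {i, k} := h
      rw [← Finset.union_sdiff_cancel_right hy', h', Finset.union_sdiff_cancel_right hz']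
    have himage : (doubled F {i, k}).image (· ∪ {i, k}) ⊆ F.filter (i ∈ ·) := by
      intro x hx
      obtain ⟨y, hy, rfl⟩ := Finset.mem_image.1 hx
      exact Finset.mem_filter.2 ⟨(hd y hy).2.2.2, by simp⟩
    refine le_of_eq_of_le ?_ (Finset.sum_le_sum_of_subset himage)
    rw [Finset.sum_image hinj]
    refine Finset.sum_congr rfl fun y _ => ?_
    congr 2
    ext j
    simp only [Finset.mem_sdiff, Finset.mem_union, Finset.mem_insert, Finset.mem_singleton]
    refine and_congr_right fun hj => not_congr ⟨Or.inl, ?_⟩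
    rintro (h | rfl | rfl)
    · exact h
    · exact absurd hj hi
    · exact absurd hj hk
  have h₂ : ∑ y ∈ doubled F {i, k}, excess J.card (J ∩ y).card ≤
      ∑ x ∈ F with k ∉ x, excess J.card (J ∩ x).card :=
    Finset.sum_le_sum_of_subset fun y hy =>
      Finset.mem_filter.2 ⟨(hd y hy).1, (hd y hy).2.2.1⟩
  refine le_trans ?_ (Nat.add_le_add h₁ h₂)
  rw [← Finset.sum_add_distrib, mul_comm, ← smul_eq_mul, ← Finset.sum_const]
  exact Finset.sum_le_sum fun y _ =>
    (excess_add_excess hJ (Finset.card_sdiff_add_card_inter J y)).ge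

/-- Holds column by column: a column counted on the left is mixed on `J` unless it is constant with
the value opposite to the expected one. -/
theorem card_cols_add_card_mixed_sep_le (hik : RowLE F i k) (hJ : J.Nonempty) :
    (upperCols F i J).card + (lowerCols F k J).card + (mixed (sep F i k) J).card ≤
      (mixed F J).card + ((upperAntiCols F i J).card + (lowerAntiCols F k J).card) := by
  simp only [upperCols, lowerCols, upperAntiCols, lowerAntiCols, mixed, sep, Finset.filter_filter]
  simp only [Finset.card_filter, ← Finset.sum_add_distrib]
  refine Finset.sum_le_sum fun x hx => ?_
  have h₁ := hik x hx
  have h₂ : ¬ (Disjoint x J ∧ J ⊆ x) := fun h =>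
    hJ.ne_empty (Finset.disjoint_self_iff_empty J |>.1 (h.1.mono_left h.2))
  by_cases hi : i ∈ x <;> by_cases hk : k ∈ x <;> by_cases hd : Disjoint x J <;>
    by_cases hs : J ⊆ x <;> simp_all

/-- Both doubled sets embed in `sep F i k`, the second by inserting `k`. Split by the behaviour on
`J`: the mixed parts may use the same columns twice. Of the constant parts, one of each set is sent
to `sep F i k`, on disjoint targets, and the other to the anti-columns. -/
theorem card_doubled_add_card_doubled_le (hik : RowLE F i k) (hne : i ≠ k) (hi : i ∉ J)
    (hk : k ∉ J) (hJ : J.Nonempty) :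
    (doubled F {i}).card + (doubled F {k}).card ≤ (sep F i k).card + (mixed (sep F i k) J).card +
      ((upperAntiCols F i J).card + (lowerAntiCols F k J).card) := by
  have hsplit : ∀ G : Finset (Finset α), G.card =
      (mixed G J).card + {x ∈ G | Disjoint x J}.card + {x ∈ G | J ⊆ x}.card := by
    intro G
    simp only [mixed, Finset.card_filter, ← Finset.sum_add_distrib]
    rw [Finset.card_eq_sum_ones]
    refine Finset.sum_congr rfl fun x _ => ?_
    have h₂ : ¬ (Disjoint x J ∧ J ⊆ x) := fun h =>
      hJ.ne_empty (Finset.disjoint_self_iff_empty J |>.1 (h.1.mono_left h.2))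
    by_cases hd : Disjoint x J <;> by_cases hs : J ⊆ x <;> simp_all
  have hdi : ∀ y ∈ doubled F {i}, y ∈ sep F i k ∧ insert i y ∈ F := by
    intro y hy
    obtain ⟨h₁, h₂, h₃⟩ := mem_doubled.1 hy
    rw [Finset.union_comm, ← Finset.insert_eq] at h₃
    refine ⟨mem_sep.2 ⟨h₁, Finset.disjoint_singleton_right.1 h₂, ?_⟩, h₃⟩
    exact (Finset.mem_insert.1 (hik _ h₃ (Finset.mem_insert_self i y))).resolve_left hne.symm
  have hdk : ∀ y ∈ doubled F {k}, y ∈ F ∧ k ∉ y ∧ insert k y ∈ sep F i k := by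
    intro y hy
    obtain ⟨h₁, h₂, h₃⟩ := mem_doubled.1 hy
    rw [Finset.union_comm, ← Finset.insert_eq] at h₃
    rw [Finset.disjoint_singleton_right] at h₂
    refine ⟨h₁, h₂, mem_sep.2 ⟨h₃, fun h => ?_, Finset.mem_insert_self k y⟩⟩
    exact h₂ (hik y h₁ ((Finset.mem_insert.1 h).resolve_left hne))
  have hdisj : ∀ {a : α}, a ∉ J → ∀ y : Finset α, Disjoint (insert a y) J ↔ Disjoint y J :=
    fun ha y => by rw [Finset.disjoint_insert_left, and_iff_right ha]
  have hsub : ∀ {a : α}, a ∉ J → ∀ y : Finset α, J ⊆ insert a y ↔ J ⊆ y :=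
    fun ha y => Finset.subset_insert_iff_of_notMem ha
  have e₁ : (mixed (doubled F {i}) J).card ≤ (mixed (sep F i k) J).card :=
    Finset.card_le_card (Finset.filter_subset_filter _ fun y hy => (hdi y hy).1)
  have e₂ : {x ∈ doubled F {i} | J ⊆ x}.card ≤ {x ∈ sep F i k | J ⊆ x}.card :=
    Finset.card_le_card (Finset.filter_subset_filter _ fun y hy => (hdi y hy).1)
  have e₃ : {x ∈ doubled F {i} | Disjoint x J}.card ≤ (upperAntiCols F i J).card := by
    refine Finset.card_le_card_of_injOn (insert i) (fun y hy => ?_) fun y hy z hz h => ?_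
    · obtain ⟨hy, hyJ⟩ := Finset.mem_filter.1 (Finset.mem_coe.1 hy)
      exact Finset.mem_coe.2 (Finset.mem_filter.2
        ⟨(hdi y hy).2, Finset.mem_insert_self i y, (hdisj hi y).2 hyJ⟩)
    · have hy' := (mem_sep.1 (hdi y (Finset.mem_filter.1 (Finset.mem_coe.1 hy)).1).1).2.1
      have hz' := (mem_sep.1 (hdi z (Finset.mem_filter.1 (Finset.mem_coe.1 hz)).1).1).2.1
      rw [← Finset.erase_insert hy', h, Finset.erase_insert hz']
  have hinj : Set.InjOn (insert k) (doubled F {k} : Set (Finset α)) := by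
    intro y hy z hz h
    rw [← Finset.erase_insert (hdk y hy).2.1, h, Finset.erase_insert (hdk z hz).2.1]
  have f₁ : (mixed (doubled F {k}) J).card ≤ (mixed (sep F i k) J).card := by
    refine Finset.card_le_card_of_injOn (insert k) (fun y hy => ?_) fun y hy z hz h => ?_
    · obtain ⟨hy, h₁, h₂⟩ := mem_mixed.1 (Finset.mem_coe.1 hy)
      exact Finset.mem_coe.2 (mem_mixed.2
        ⟨(hdk y hy).2.2, (hdisj hk y).not.2 h₁, (hsub hk y).not.2 h₂⟩)
    · exact hinj (mem_mixed.1 (Finset.mem_coe.1 hy)).1 (mem_mixed.1 (Finset.mem_coe.1 hz)).1 h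
  have f₂ : {x ∈ doubled F {k} | Disjoint x J}.card ≤ {x ∈ sep F i k | Disjoint x J}.card := by
    refine Finset.card_le_card_of_injOn (insert k) (fun y hy => ?_) fun y hy z hz h => ?_
    · obtain ⟨hy, h₁⟩ := Finset.mem_filter.1 (Finset.mem_coe.1 hy)
      exact Finset.mem_coe.2 (Finset.mem_filter.2 ⟨(hdk y hy).2.2, (hdisj hk y).2 h₁⟩)
    · exact hinj (Finset.mem_filter.1 (Finset.mem_coe.1 hy)).1
        (Finset.mem_filter.1 (Finset.mem_coe.1 hz)).1 h
  have f₃ : {x ∈ doubled F {k} | J ⊆ x}.card ≤ (lowerAntiCols F k J).card := by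
    refine Finset.card_le_card fun y hy => ?_
    obtain ⟨hy, hyJ⟩ := Finset.mem_filter.1 hy
    exact Finset.mem_filter.2 ⟨(hdk y hy).1, (hdk y hy).2.1, hyJ⟩
  have s₁ := hsplit (doubled F {i})
  have s₂ := hsplit (doubled F {k})
  have s₃ := hsplit (sep F i k)
  omega

theorem card_upperCols_le_sum (F : Finset (Finset α)) (i : α) (J : Finset α) :
    (upperCols F i J).card ≤ ∑ x ∈ F with i ∈ x, (J \ x).card := by
  rw [upperCols, ← Finset.filter_filter, Finset.card_filter]
  refine Finset.sum_le_sum fun x _ => ?_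
  split_ifs with h
  · exact Nat.zero_le _
  · exact Finset.card_pos.2 (Finset.sdiff_nonempty.2 h)

theorem card_lowerCols_le_sum (F : Finset (Finset α)) (k : α) (J : Finset α) :
    (lowerCols F k J).card ≤ ∑ x ∈ F with k ∉ x, (J ∩ x).card := by
  rw [lowerCols, ← Finset.filter_filter, Finset.card_filter]
  refine Finset.sum_le_sum fun x _ => ?_
  split_ifs with h
  · exact Nat.zero_le _
  · rw [Nat.succ_le_iff, Finset.card_pos, Finset.inter_comm]
    exact Finset.not_disjoint_iff_nonempty_inter.1 h

end ForbConfig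

/-! ### Excluding a counterexample with an induced path -/

namespace ForbConfig

variable {α : Type*} [DecidableEq α] {F : Finset (Finset α)} {J V : Finset α} {i k : α}

/-- Here `r = |J|`, `M = |sep F i k|`, `Z` counts upper and lower columns, `z` the anti-columns, and
`w`, `ti`, `tk` the doubled columns of `{i, k}`, `{i}`, `{k}`. `mJ` and `m` count the columns mixed
on `J` in `F` and in `sep F i k`, and `S` is the total deviation on `J`. -/
theorem path_arithmetic {p r M Z w z m S mJ ti tk : ℕ} (hp3 : 3 ≤ p) (hp9 : p ≤ 9) (hr : 2 ≤ r)
    (hR : S + r * M ≤ r * (2 * (p - 1))) (hP : (r - 2) * w + (Z + z) ≤ S)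
    (hJ : Z + m ≤ mJ + z) (hmJ : mJ ≤ r * (p - 1)) (hT : ti + tk ≤ M + m + z)
    (hD₂ : c p * (r + 2) < M + Z + 2) (hD₁ : c p * 2 < M + w + 1)
    (hi : c p < ti + 1) (hk : c p < tk + 1) :
    p = 8 ∧ r = 2 ∧ ti ≤ 5 ∧ tk ≤ 5 ∧ 12 ≤ Z := by
  obtain ⟨a, rfl⟩ := Nat.exists_eq_add_of_le hr
  -- The combination takes `hD₂` three times, `hD₁` with weight `2a`, and `hP` and `hR` twice; this
  -- eliminates `M`, `Z`, `w`, `z` and `m`.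
  have large : ∀ q : ℕ, p = q + 1 → (a + 2 : ℚ) * (7 * c p - 2 - 5 * q) < 4 := by
    rintro q rfl
    simp only [Nat.add_sub_cancel, Nat.add_sub_cancel_left] at hR hP hmJ
    have hR' : (S + (2 + a) * M : ℚ) ≤ (2 + a) * (2 * q) := by exact_mod_cast hR
    have hP' : (a * w + (Z + z) : ℚ) ≤ S := by exact_mod_cast hP
    have hJ' : (Z + m : ℚ) ≤ mJ + z := by exact_mod_cast hJ
    have hmJ' : (mJ : ℚ) ≤ (2 + a) * q := by exact_mod_cast hmJ
    have hT' : (ti + tk : ℚ) ≤ M + m + z := by exact_mod_cast hT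
    have hprod : 0 ≤ (a : ℚ) * (M + w + 1 - c (q + 1) * 2) :=
      mul_nonneg (Nat.cast_nonneg a) (by linarith)
    push_cast at hD₂
    generalize c (q + 1) = d at *
    nlinarith
  -- Clearing denominators makes integrality available.
  have small : ∀ A B : ℕ, 0 < B → c p = A / B → A * (a + 4) < B * (M + Z + 2) ∧
      A * 2 < B * (M + w + 1) ∧ A < B * (ti + 1) ∧ A < B * (tk + 1) := by
    intro A B hB h
    have hB' : (0 : ℚ) < B := by exact_mod_cast hB
    rw [h, div_mul_eq_mul_div, div_lt_iff₀' hB'] at hD₂ hD₁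
    rw [h, div_lt_iff₀' hB'] at hi hk
    refine ⟨?_, by exact_mod_cast hD₁, by exact_mod_cast hi, by exact_mod_cast hk⟩
    rw [show a + 4 = 2 + a + 2 by ring]
    exact_mod_cast hD₂
  have hlarge := large (p - 1) (by omega)
  clear large hD₂ hD₁ hi hk
  -- Only `p = 7, 9` with `r = 2` and `p = 8` with `r ≤ 4` pass `hlarge`.
  rcases Nat.lt_or_ge a 3 with ha | ha
  · have h₇ := small 24 5
    have h₈ := small 27 5
    have h₉ := small 31 5
    clear small
    interval_cases p <;> interval_cases a <;> norm_num [c] at hlarge <;>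
      norm_num [c] at h₇ h₈ h₉ <;> omega
  · have ha' : (3 : ℚ) ≤ a := by exact_mod_cast ha
    exfalso
    interval_cases p <;> norm_num [c] at hlarge <;> linarith

theorem hasInducedPath_deletion {v a b e : α} (ha : a ≠ v) (hb : b ≠ v) (he : e ≠ v)
    (h₁ : Incomp F a b) (h₂ : Incomp F b e) (hne : a ≠ e) (h₃ : ¬ Incomp F a e) :
    HasInducedPath (deletion F {v}) := by
  rw [ne_eq, ← Finset.mem_singleton] at ha hb he
  exact ⟨a, b, e, (incomp_deletion ha hb).2 h₁, (incomp_deletion hb he).2 h₂, hne,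
    (incomp_deletion ha he).not.2 h₃⟩

/-- Let `d ∈ x \ y` have equal traces around it, and let `j ∈ J \ x`. If `d` is incomparable to `i`
and `k`, maximality of `J` yields `v ∈ J` and an induced path `d, k, v`. Otherwise `d ≤ k`, and `d,
j, k` is an induced path. Both avoid `i`. -/
theorem inter_injOn_upperCols (hno : ¬ HasInducedPath (deletion F {i}))
    (hJ : ∀ j ∈ J, Incomp F i j ∧ Incomp F j k)
    (hdom : ∀ l, Incomp F i l → Incomp F l k → l ∉ J → ∃ v ∈ J, ¬ Incomp F l v)
    (hik : RowLE F i k) (hne : i ≠ k) :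
    Set.InjOn (J ∩ ·) (upperCols F i J : Set (Finset α)) := by
  have key : ∀ x ∈ upperCols F i J, ∀ y ∈ upperCols F i J, J ∩ x = J ∩ y → x ⊆ y := by
    intro x hx y hy hxy d hdx
    by_contra hdy
    obtain ⟨hxF, hix, hJx⟩ := Finset.mem_filter.1 hx
    obtain ⟨hyF, hiy, -⟩ := Finset.mem_filter.1 hy
    obtain ⟨j, hj, hjx⟩ := Finset.not_subset.1 hJx
    have hdJ : d ∉ J := fun h => hdy (Finset.mem_inter.1 (hxy ▸ Finset.mem_inter.2 ⟨h, hdx⟩)).2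
    have hid : ¬ RowLE F i d := fun h => hdy (h y hyF hiy)
    have hkd : ¬ RowLE F k d := fun h => hdy (h y hyF (hik y hyF hiy))
    have hdj : ¬ RowLE F d j := fun h => hjx (h x hxF hdx)
    have hdi : d ≠ i := fun h => hdy (h ▸ hiy)
    have hdk : d ≠ k := fun h => hdy (h ▸ hik y hyF hiy)
    by_cases h : Incomp F d k
    · by_cases h' : Incomp F i d
      · obtain ⟨v, hv, hdv⟩ := hdom d h' h hdJ
        exact hno (hasInducedPath_deletion hdi hne.symm (hJ v hv).1.ne.symm h (hJ v hv).2.symm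
          (fun h => hdJ (h ▸ hv)) hdv)
      · exact h.not_rowLE (((rowLE_or_rowLE_of_not_incomp h').resolve_left hid).trans hik)
    · have hdk' := (rowLE_or_rowLE_of_not_incomp h).resolve_right hkd
      have hjd : ¬ RowLE F j d := fun h => (hJ j hj).2.not_rowLE (h.trans hdk')
      exact hno (hasInducedPath_deletion hdi (hJ j hj).1.ne.symm hne.symm
        (incomp_of_not_rowLE hdj hjd) (hJ j hj).2 hdk h)
  exact fun x hx y hy h => (key x hx y hy h).antisymm (key y hy x hx h.symm)

theorem inter_injOn_lowerCols (hno : ¬ HasInducedPath (deletion F {k}))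
    (hJ : ∀ j ∈ J, Incomp F i j ∧ Incomp F j k)
    (hdom : ∀ l, Incomp F i l → Incomp F l k → l ∉ J → ∃ v ∈ J, ¬ Incomp F l v)
    (hik : RowLE F i k) (hne : i ≠ k) :
    Set.InjOn (J ∩ ·) (lowerCols F k J : Set (Finset α)) := by
  have key : ∀ x ∈ lowerCols F k J, ∀ y ∈ lowerCols F k J, J ∩ x = J ∩ y → x ⊆ y := by
    intro x hx y hy hxy d hdx
    by_contra hdy
    obtain ⟨hxF, hkx, hJx⟩ := Finset.mem_filter.1 hx
    obtain ⟨hyF, hky, -⟩ := Finset.mem_filter.1 hy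
    obtain ⟨j, hjx, hj⟩ := Finset.not_disjoint_iff.1 hJx
    have hjy := (Finset.mem_inter.1 (hxy ▸ Finset.mem_inter.2 ⟨hj, hjx⟩ : j ∈ J ∩ y)).2
    have hdJ : d ∉ J := fun h => hdy (Finset.mem_inter.1 (hxy ▸ Finset.mem_inter.2 ⟨h, hdx⟩)).2
    have hdk' : ¬ RowLE F d k := fun h => hkx (h x hxF hdx)
    have hdi' : ¬ RowLE F d i := fun h => hdk' (h.trans hik)
    have hjd : ¬ RowLE F j d := fun h => hdy (h y hyF hjy)
    have hdk : d ≠ k := fun h => hkx (h ▸ hdx)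
    have hdi : d ≠ i := fun h => hkx (hik x hxF (h ▸ hdx))
    by_cases h : Incomp F i d
    · by_cases h' : Incomp F d k
      · obtain ⟨v, hv, hdv⟩ := hdom d h h' hdJ
        exact hno (hasInducedPath_deletion hdk hne (hJ v hv).2.ne h.symm (hJ v hv).1
          (fun h => hdJ (h ▸ hv)) hdv)
      · exact h.not_rowLE (hik.trans ((rowLE_or_rowLE_of_not_incomp h').resolve_left hdk'))
    · have hid := (rowLE_or_rowLE_of_not_incomp h).resolve_right hdi'
      have hdj : ¬ RowLE F d j := fun h => (hJ j hj).1.not_rowLE (hid.trans h)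
      exact hno (hasInducedPath_deletion hdk (hJ j hj).2.ne hne
        (incomp_of_not_rowLE hdj hjd) (hJ j hj).1.symm hdi fun h' => h h'.symm)
  exact fun x hx y hy h => (key x hx y hy h).antisymm (key y hy x hx h.symm)

/-- The trace `J` is missing; for lower columns the trace `∅` is. -/
theorem card_upperCols_lt (h : Set.InjOn (J ∩ ·) (upperCols F i J : Set (Finset α))) :
    (upperCols F i J).card < 2 ^ J.card := by
  rw [← Finset.card_powerset, ← Finset.card_image_of_injOn h]
  refine Finset.card_lt_card (Finset.ssubset_iff_of_subset ?_ |>.2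
    ⟨J, Finset.mem_powerset_self J, fun hJ => ?_⟩)
  · intro y hy
    obtain ⟨x, -, rfl⟩ := Finset.mem_image.1 hy
    exact Finset.mem_powerset.2 Finset.inter_subset_left
  · obtain ⟨x, hx, hxJ⟩ := Finset.mem_image.1 hJ
    exact (Finset.mem_filter.1 hx).2.2 (Finset.inter_eq_left.1 hxJ)

theorem card_lowerCols_lt (h : Set.InjOn (J ∩ ·) (lowerCols F k J : Set (Finset α))) :
    (lowerCols F k J).card < 2 ^ J.card := by
  rw [← Finset.card_powerset, ← Finset.card_image_of_injOn h]
  refine Finset.card_lt_card (Finset.ssubset_iff_of_subset ?_ |>.2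
    ⟨∅, Finset.empty_mem_powerset J, fun hJ => ?_⟩)
  · intro y hy
    obtain ⟨x, -, rfl⟩ := Finset.mem_image.1 hy
    exact Finset.mem_powerset.2 Finset.inter_subset_left
  · obtain ⟨x, hx, hxJ⟩ := Finset.mem_image.1 hJ
    exact (Finset.mem_filter.1 hx).2.2 (Finset.disjoint_iff_inter_eq_empty.2
      ((Finset.inter_comm _ _).trans hxJ))

theorem exists_maximal_clique {b : α} (hV : ∀ x ∈ F, x ⊆ V) (hib : Incomp F i b)
    (hbk : Incomp F b k) :
    ∃ J ⊆ V, J.Nonempty ∧ (∀ j ∈ J, Incomp F i j ∧ Incomp F j k) ∧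
      (∀ u ∈ J, ∀ v ∈ J, u ≠ v → Incomp F u v) ∧
      ∀ l, Incomp F i l → Incomp F l k → l ∉ J → ∃ v ∈ J, ¬ Incomp F l v := by
  classical
  let P : Finset α → Prop := fun J => (∀ j ∈ J, Incomp F i j ∧ Incomp F j k) ∧
    ∀ u ∈ J, ∀ v ∈ J, u ≠ v → Incomp F u v
  obtain ⟨J, hJ, hmax⟩ := Finset.exists_max_image (V.powerset.filter P) Finset.card
    ⟨∅, Finset.mem_filter.2 ⟨Finset.empty_mem_powerset V, by simp, by simp⟩⟩
  obtain ⟨hJV, hJ₁, hJ₂⟩ := Finset.mem_filter.1 hJ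
  rw [Finset.mem_powerset] at hJV
  have hdom : ∀ l, Incomp F i l → Incomp F l k → l ∉ J → ∃ v ∈ J, ¬ Incomp F l v := by
    intro l hil hlk hl
    by_contra! hcon
    have hmem : insert l J ∈ V.powerset.filter P := by
      refine Finset.mem_filter.2 ⟨Finset.mem_powerset.2
        (Finset.insert_subset (hlk.mem hV) hJV), fun j hj => ?_, fun u hu v hv huv => ?_⟩
      · rcases Finset.mem_insert.1 hj with rfl | hj
        exacts [⟨hil, hlk⟩, hJ₁ j hj]
      · rcases Finset.mem_insert.1 hu with rfl | hu' <;>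
          rcases Finset.mem_insert.1 hv with rfl | hv'
        · exact absurd rfl huv
        · exact hcon v hv'
        · exact (hcon u hu').symm
        · exact hJ₂ u hu' v hv' huv
    have := hmax _ hmem
    rw [Finset.card_insert_of_notMem hl] at this
    omega
  refine ⟨J, hJV, ?_, hJ₁, hJ₂, hdom⟩
  by_contra! hJe
  obtain ⟨v, hv, -⟩ := hdom b hib hbk (by simp [hJe])
  simp [hJe] at hv

/-- `hQ` and `hQ'` say what the induction hypothesis yields for a family with more than `c_p |V|`
columns; `hQ'` is the gain when the deletion keeps an induced path. -/
theorem false_of_rowLE {p : ℕ} {b : α} (hp3 : 3 ≤ p) (hp9 : p ≤ 9) (hF : SepBounded (p - 1) F)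
    (hV : ∀ x ∈ F, x ⊆ V) (hik : RowLE F i k) (hne : i ≠ k) (hib : Incomp F i b)
    (hbk : Incomp F b k)
    (hQ : ∀ Q ⊆ V, Q.Nonempty →
      c p * Q.card < (mixed F Q).card + (doubled F Q).card + 1)
    (hQ' : ∀ Q ⊆ V, Q.Nonempty → HasInducedPath (deletion F Q) →
      c p * Q.card < (mixed F Q).card + (doubled F Q).card) : False := by
  obtain ⟨J, hJV, hJne, hJ, hclique, hdom⟩ := exists_maximal_clique hV hib hbk
  have hiV := hib.mem hV
  have hkV := hbk.symm.mem hV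
  have hiJ : i ∉ J := fun h => (hJ i h).1.ne rfl
  have hkJ : k ∉ J := fun h => (hJ k h).2.ne rfl
  have hsep : ∀ j ∈ J, (sep F i j).card ≤ p - 1 ∧ (sep F j k).card ≤ p - 1 :=
    fun j hj => ⟨(hJ j hj).1.card_sep_le hF, (hJ j hj).2.card_sep_le hF⟩
  have hR := sum_off_add_le hik hsep
  have hmJ := card_mixed_le fun u hu v hv huv => (hclique u hu v hv huv).card_sep_le hF
  have hZ := card_cols_add_card_mixed_sep_le hik hJne
  have hT := card_doubled_add_card_doubled_le hik hne hiJ hkJ hJne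
  have hD₂ : c p * (J.card + 2) <
      (sep F i k).card + ((upperCols F i J).card + (lowerCols F k J).card : ℕ) + 2 := by
    have h₁ := hQ (insert i (insert k J))
      (Finset.insert_subset hiV (Finset.insert_subset hkV hJV)) (Finset.insert_nonempty _ _)
    rw [Finset.card_insert_of_notMem (by simp [hne, hiJ]), Finset.card_insert_of_notMem hkJ] at h₁
    -- By maximality of `J`, no row outside is incomparable to all of `J ∪ {i, k}`.
    have h₂ : (doubled F (insert i (insert k J))).card ≤ 1 := by
      refine card_doubled_le_one fun l _ hl => ?_
      simp only [Finset.mem_insert, not_or] at hl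
      by_contra! hcon
      obtain ⟨v, hv, hlv⟩ := hdom l (hcon i (by simp)).symm (hcon k (by simp)) hl.2.2
      exact hlv (hcon v (by simp [hv]))
    have h₃ := card_mixed_insert_le (J := J) hik
    rify at h₁ h₂ h₃ ⊢
    have e : (J.card : ℝ) + 1 + 1 = J.card + 2 := by ring
    rw [e] at h₁
    linarith
  have hD₁ : c p * 2 < (sep F i k).card + (doubled F {i, k}).card + 1 := by
    have h₁ := hQ {i, k} (by simp [Finset.insert_subset_iff, hiV, hkV]) (Finset.insert_nonempty _ _)
    rw [Finset.card_pair hne] at h₁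
    have h₂ : ((mixed F {i, k}).card : ℚ) ≤ (sep F i k).card := by
      exact_mod_cast card_mixed_pair hik
    push_cast at h₁
    linarith
  have hD : ∀ v ∈ V, c p < (doubled F {v}).card + 1 := by
    intro v hv
    have := hQ {v} (by simpa using hv) (Finset.singleton_nonempty v)
    simpa [mixed_singleton] using this
  have hD' : ∀ v ∈ V, HasInducedPath (deletion F {v}) → c p < (doubled F {v}).card := by
    intro v hv h
    have := hQ' {v} (by simpa using hv) (Finset.singleton_nonempty v) h
    simpa [mixed_singleton] using this
  -- For `|J| = 1` the counts would give `3 c_p < 2p`, which fails for every `p` in the range.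
  rcases Nat.lt_or_ge J.card 2 with hr | hr
  · have hr1 : J.card = 1 := by
      have := hJne.card_pos
      omega
    have h₁ := card_upperCols_le_sum F i J
    have h₂ := card_lowerCols_le_sum F k J
    rw [hr1] at hR hD₂
    have h₃ : (sep F i k).card + ((upperCols F i J).card + (lowerCols F k J).card) ≤ 2 * (p - 1) := by
      omega
    have h₄ : ((sep F i k).card + ((upperCols F i J).card + (lowerCols F k J).card : ℕ) : ℚ) ≤
        (2 * (p - 1) : ℕ) := by exact_mod_cast h₃
    interval_cases p <;> norm_num [c] at hD₂ h₄ <;> linarith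
  · have hP := mul_card_doubled_le (F := F) hr hiJ hkJ
    have h₁ := card_upperCols_add (F := F) (i := i) hr
    have h₂ := card_lowerCols_add (F := F) (k := k) hr
    obtain ⟨rfl, hr2, hti, htk, hZ12⟩ := path_arithmetic hp3 hp9 hr hR
      (w := (doubled F {i, k}).card) (Z := (upperCols F i J).card + (lowerCols F k J).card)
      (z := (upperAntiCols F i J).card + (lowerAntiCols F k J).card) (by omega) hZ hmJ hT hD₂ hD₁
      (hD i hiV) (hD k hkV)
    -- If the path survived, `hD'` would require more than `c_8 = 27/5` doubled columns.
    have hno : ∀ v ∈ V, (doubled F {v}).card ≤ 5 → ¬ HasInducedPath (deletion F {v}) := by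
      intro v hv h₅ h
      have h₆ := hD' v hv h
      have h₇ : ((doubled F {v}).card : ℚ) ≤ 5 := by exact_mod_cast h₅
      norm_num [c] at h₆
      linarith
    have h₃ := card_upperCols_lt (inter_injOn_upperCols (hno i hiV hti) hJ hdom hik hne)
    have h₄ := card_lowerCols_lt (inter_injOn_lowerCols (hno k hkV htk) hJ hdom hik hne)
    rw [hr2] at h₃ h₄
    -- At most 3 upper and 3 lower columns, against the required 12.
    omega

end ForbConfig

/-! ### Clique components and the induction -/

namespace ForbConfig

variable {α : Type*} [DecidableEq α] {F : Finset (Finset α)} {K V : Finset α}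

/-- If the incomparable rows form a disjoint union of cliques, then the columns that are not
constant on the clique of a row agree outside of it. -/
theorem inter_injOn_mixed (hno : ¬ HasInducedPath F) {v : α}
    (hK : ∀ u, u ∈ K ↔ u = v ∨ Incomp F v u) :
    Set.InjOn (K ∩ ·) (mixed F K : Set (Finset α)) := by
  have htrans : ∀ a b e, Incomp F a b → Incomp F b e → a ≠ e → Incomp F a e := by
    intro a b e h₁ h₂ hne
    by_contra h
    exact hno ⟨a, b, e, h₁, h₂, hne, h⟩
  have hclique : ∀ a ∈ K, ∀ b ∈ K, a ≠ b → Incomp F a b := by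
    intro a ha b hb hab
    rcases (hK a).1 ha with rfl | ha' <;> rcases (hK b).1 hb with rfl | hb'
    · exact absurd rfl hab
    · exact hb'
    · exact ha'.symm
    · exact htrans _ _ _ ha'.symm hb' hab
  have hclosed : ∀ a ∈ K, ∀ l, Incomp F a l → l ∈ K := by
    intro a ha l hal
    by_cases hlv : l = v
    · exact (hK l).2 (Or.inl hlv)
    · rcases (hK a).1 ha with rfl | ha'
      · exact (hK l).2 (Or.inr hal)
      · exact (hK l).2 (Or.inr (htrans _ _ _ ha' hal (Ne.symm hlv)))
  have key : ∀ x ∈ mixed F K, ∀ y ∈ mixed F K, K ∩ x = K ∩ y → x ⊆ y := by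
    intro x hx y hy hxy l hlx
    by_contra hly
    obtain ⟨hxF, -, hKx⟩ := mem_mixed.1 hx
    obtain ⟨hyF, hyK, -⟩ := mem_mixed.1 hy
    have hlK : l ∉ K := fun h => hly (Finset.mem_inter.1 (hxy ▸ Finset.mem_inter.2 ⟨h, hlx⟩)).2
    obtain ⟨b, hb, hbx⟩ := Finset.not_subset.1 hKx
    obtain ⟨a, hay, ha⟩ := Finset.not_disjoint_iff.1 hyK
    have hax : a ∈ x := (Finset.mem_inter.1 (hxy ▸ Finset.mem_inter.2 ⟨ha, hay⟩ : a ∈ K ∩ x)).2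
    have hbl : RowLE F b l :=
      (rowLE_or_rowLE_of_not_incomp fun h => hlK (hclosed b hb l h)).resolve_right
        fun h => hbx (h x hxF hlx)
    have hla : RowLE F l a :=
      (rowLE_or_rowLE_of_not_incomp fun h => hlK (hclosed a ha l h)).resolve_left
        fun h => hly (h y hyF hay)
    -- `b ≤ l ≤ a` makes two rows of the clique comparable.
    exact (hclique b hb a ha fun h => hbx (h ▸ hax)).not_rowLE (hbl.trans hla)
  exact fun x hx y hy h => (key x hx y hy h).antisymm (key y hy x hx h.symm)

theorem card_mixed_add_one_le {p : ℕ} (hp3 : 3 ≤ p) (hp9 : p ≤ 9) (hF : SepBounded (p - 1) F)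
    (hne : K.Nonempty) (hK : ∀ u ∈ K, ∀ v ∈ K, u ≠ v → Incomp F u v)
    (hinj : Set.InjOn (K ∩ ·) (mixed F K : Set (Finset α))) :
    ((mixed F K).card : ℚ) + 1 ≤ c p * K.card := by
  rw [← Finset.card_image_of_injOn hinj]
  refine card_add_one_le_c_mul hp3 hp9 hne (fun y hy => ?_) (fun y hy => ?_)
    fun u hu v hv huv => ?_
  · obtain ⟨x, hx, rfl⟩ := Finset.mem_image.1 hy
    exact Finset.inter_subset_left.ssubset_of_ne fun h =>
      (mem_mixed.1 hx).2.2 (Finset.inter_eq_left.1 h)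
  · obtain ⟨x, hx, rfl⟩ := Finset.mem_image.1 hy
    rw [Finset.inter_comm]
    exact Finset.not_disjoint_iff_nonempty_inter.1 (mem_mixed.1 hx).2.1
  · refine le_trans ?_ ((hK u hu v hv huv).card_sep_le hF)
    refine le_trans (Finset.card_le_card (t := (sep F u v).image (K ∩ ·)) fun y hy => ?_)
      Finset.card_image_le
    obtain ⟨hy, huy, hvy⟩ := mem_sep.1 hy
    obtain ⟨x, hx, rfl⟩ := Finset.mem_image.1 hy
    refine Finset.mem_image_of_mem _ (mem_sep.2 ⟨(mem_mixed.1 hx).1, fun h => ?_, ?_⟩)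
    · exact huy (Finset.mem_inter.2 ⟨hu, h⟩)
    · exact (Finset.mem_inter.1 hvy).2

/-- The sharper bound under an induced path belongs to the induction: it provides `hQ'` for the
exceptional case `p = 8`, and it is what produces the deletion of cost at least 1. -/
theorem card_le_of_sepBounded {p : ℕ} (hp3 : 3 ≤ p) (hp9 : p ≤ 9) (V : Finset α) :
    ∀ F : Finset (Finset α), (∀ x ∈ F, x ⊆ V) → SepBounded (p - 1) F →
      (F.card : ℚ) ≤ c p * V.card + 1 ∧ (HasInducedPath F → (F.card : ℚ) ≤ c p * V.card) := by
  classical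
  induction V using Finset.strongInduction with
  | H V ih =>
  intro F hV hF
  have hdel : ∀ Q ⊆ V, Q.Nonempty →
      ((deletion F Q).card : ℚ) ≤ c p * (V.card - Q.card) + 1 ∧
      (HasInducedPath (deletion F Q) → ((deletion F Q).card : ℚ) ≤ c p * (V.card - Q.card)) := by
    intro Q hQV hQ
    have := ih (V \ Q) (Finset.sdiff_ssubset hQV hQ) (deletion F Q) (deletion_subset hV)
      (hF.deletion Q)
    rwa [Finset.cast_card_sdiff hQV] at this
  have hcard : ∀ Q, (F.card : ℚ) ≤
      (deletion F Q).card + (mixed F Q).card + (doubled F Q).card := fun Q => by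
    exact_mod_cast card_le_deletion_add F Q
  have hpath : HasInducedPath F → (F.card : ℚ) ≤ c p * V.card := by
    rintro ⟨a, b, e, hab, hbe, hae, hne⟩
    by_contra! hlt
    have hQ : ∀ Q ⊆ V, Q.Nonempty →
        c p * Q.card < (mixed F Q).card + (doubled F Q).card + 1 := by
      intro Q hQV hQ
      have h₁ := (hdel Q hQV hQ).1
      have h₂ := hcard Q
      linarith
    have hQ' : ∀ Q ⊆ V, Q.Nonempty → HasInducedPath (deletion F Q) →
        c p * Q.card < (mixed F Q).card + (doubled F Q).card := by
      intro Q hQV hQ h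
      have h₁ := (hdel Q hQV hQ).2 h
      have h₂ := hcard Q
      linarith
    rcases rowLE_or_rowLE_of_not_incomp hne with h | h
    · exact false_of_rowLE hp3 hp9 hF hV h hae hab hbe hQ hQ'
    · exact false_of_rowLE hp3 hp9 hF hV h hae.symm hbe.symm hab.symm hQ hQ'
  refine ⟨?_, hpath⟩
  by_cases hP : HasInducedPath F
  · exact (hpath hP).trans (by linarith)
  rcases V.eq_empty_or_nonempty with rfl | ⟨v, hv⟩
  · have h : F ⊆ {∅} := fun x hx => Finset.mem_singleton.2 (Finset.subset_empty.1 (hV x hx))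
    have h₂ : (F.card : ℚ) ≤ 1 := by exact_mod_cast Finset.card_le_card h
    simpa using h₂
  -- Without induced paths, the closed neighbourhood of `v` is its whole component.
  set K := V.filter fun u => u = v ∨ Incomp F v u with hKdef
  have hKV : K ⊆ V := Finset.filter_subset _ _
  have hK : ∀ u, u ∈ K ↔ u = v ∨ Incomp F v u := by
    intro u
    refine ⟨fun h => (Finset.mem_filter.1 h).2, fun h => Finset.mem_filter.2 ⟨?_, h⟩⟩
    rcases h with rfl | h
    exacts [hv, h.symm.mem hV]
  have hvK : v ∈ K := (hK v).2 (Or.inl rfl)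
  have hclique : ∀ a ∈ K, ∀ b ∈ K, a ≠ b → Incomp F a b := by
    intro a ha b hb hab
    rcases (hK a).1 ha with rfl | ha' <;> rcases (hK b).1 hb with rfl | hb'
    · exact absurd rfl hab
    · exact hb'
    · exact ha'.symm
    · by_contra h
      exact hP ⟨a, v, b, ha'.symm, hb', hab, h⟩
  have h₁ := (hdel K hKV ⟨v, hvK⟩).1
  have h₂ := hcard K
  have h₃ := card_mixed_add_one_le hp3 hp9 hF ⟨v, hvK⟩ hclique (inter_injOn_mixed hP hK)
  have h₄ : ((doubled F K).card : ℚ) ≤ 1 := by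
    exact_mod_cast card_doubled_le_one fun l _ hl =>
      ⟨v, hvK, fun h => hl ((hK l).2 (Or.inr h.symm))⟩
  linarith

/-! ### Translation between matrices and set families -/

variable {ρ κ : Type*}

/-- The set of rows in which a column has a `1`. -/
def colSupport [Fintype ρ] (A : BinMatrix ρ κ) (j : κ) : Finset ρ := {i | A i j = 1}

theorem mem_colSupport [Fintype ρ] {A : BinMatrix ρ κ} {i : ρ} {j : κ} : i ∈ colSupport A j ↔ A i j = 1 := by
  simp [colSupport]

theorem notMem_colSupport [Fintype ρ] {A : BinMatrix ρ κ} {i : ρ} {j : κ} :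
    i ∉ colSupport A j ↔ A i j = 0 := by
  rw [mem_colSupport]
  generalize A i j = x
  revert x
  decide

theorem IsSimple.colSupport_injective [Fintype ρ] {A : BinMatrix ρ κ} (hA : IsSimple A) :
    Function.Injective (colSupport A) := by
  intro j j' h
  refine hA (funext fun i => ?_)
  have h₁ := mem_colSupport (A := A) (i := i) (j := j)
  rw [h, mem_colSupport] at h₁
  change A i j = A i j'
  generalize A i j = x at *
  generalize A i j' = y at *
  revert x y
  decide

theorem hasConfig_F0p10 [Fintype κ] {A : BinMatrix ρ κ} {p : ℕ} {u v : ρ} (h₁ : p ≤ count01 A v u)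
    (h₂ : 0 < count01 A u v) : HasConfig (F0p10 p) A := by
  obtain ⟨S, hS, hSp⟩ := Finset.exists_subset_card_eq h₁
  obtain ⟨k, hk⟩ := Finset.card_pos.1 h₂
  have hk' := (Finset.mem_filter.1 hk).2
  have hS' : ∀ j ∈ S, A v j = 0 ∧ A u j = 1 := fun j hj => (Finset.mem_filter.1 (hS hj)).2
  have huv : u ≠ v := by
    rintro rfl
    simp [hk'.1] at hk'
  let e := (S.equivFinOfCardEq hSp).symm
  let f : Fin 2 ↪ ρ := ⟨![u, v], by
    intro a b
    fin_cases a <;> fin_cases b <;> simp [huv, huv.symm]⟩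
  let g' : Fin (p + 1) → κ := Fin.snoc (fun j => (e j : κ)) k
  have hg : Function.Injective g' := by
    refine Fin.snoc_injective_iff.2 ⟨Subtype.val_injective.comp e.injective, ?_⟩
    rintro ⟨j, hj⟩
    have := (hS' _ (e j).2).1
    rw [show (e j : κ) = k from hj, hk'.2] at this
    exact one_ne_zero this
  have hfu : f 0 = u := rfl
  have hfv : f 1 = v := rfl
  refine ⟨f, ⟨g', hg⟩, ?_⟩
  ext a j
  refine Fin.lastCases ?_ (fun j => ?_) j
  · have h₃ : g' (Fin.last p) = k := Fin.snoc_last (α := fun _ => κ) _ _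
    change (A (f a) (g' (Fin.last p))).val = _
    rw [h₃]
    fin_cases a
    · simpa [F0p10, hfu, hfv] using congrArg Fin.val hk'.1
    · simpa [F0p10, hfu, hfv] using congrArg Fin.val hk'.2
  · have h₃ : g' j.castSucc = e j := Fin.snoc_castSucc (α := fun _ => κ) _ _ _
    change (A (f a) (g' j.castSucc)).val = _
    rw [h₃]
    fin_cases a
    · simpa [F0p10, hfu, hfv] using congrArg Fin.val (hS' _ (e j).2).2
    · simpa [F0p10, hfu, hfv] using congrArg Fin.val (hS' _ (e j).2).1

/-- Deleting all rows and all but one column. -/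
theorem hasDeletion_of_card_le [Fintype ρ] [Nonempty ρ] [Fintype κ] {A : BinMatrix ρ κ} {p : ℕ} (hc : 1 ≤ c p)
    (h : (Fintype.card κ : ℚ) ≤ c p * Fintype.card ρ) : HasDeletionOfCostAtLeastOne p A := by
  classical
  rcases isEmpty_or_nonempty κ with hκ | ⟨⟨j⟩⟩
  · refine ⟨Finset.univ, ∅, fun j => hκ.elim j.1, ?_⟩
    have h₁ : (1 : ℚ) ≤ Fintype.card ρ := by exact_mod_cast Fintype.card_pos (α := ρ)
    simp only [cost, Finset.card_univ, Finset.card_empty, Nat.cast_zero, sub_zero]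
    nlinarith
  · refine ⟨Finset.univ, Finset.univ.erase j, fun a b _ => ?_, ?_⟩
    · have ha : a.1 = j := by simpa using a.2
      have hb : b.1 = j := by simpa using b.2
      exact Subtype.ext (ha.trans hb.symm)
    · rw [cost, Finset.card_univ, Finset.card_erase_of_mem (Finset.mem_univ j), Finset.card_univ,
        Nat.cast_pred (Fintype.card_pos_iff.2 ⟨j⟩)]
      linarith

variable [Fintype ρ] [DecidableEq ρ] [Fintype κ]

/-- The supports of the columns of a matrix. -/
def colFamily (A : BinMatrix ρ κ) : Finset (Finset ρ) := Finset.univ.image (colSupport A)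

theorem card_colFamily {A : BinMatrix ρ κ} (hA : IsSimple A) :
    (colFamily A).card = Fintype.card κ :=
  Finset.card_image_of_injective _ hA.colSupport_injective

theorem card_sep_colFamily {A : BinMatrix ρ κ} (hA : IsSimple A) (u v : ρ) :
    (sep (colFamily A) u v).card = count01 A u v := by
  rw [sep, colFamily, Finset.filter_image, Finset.card_image_of_injective _ hA.colSupport_injective,
    count01]
  refine congrArg _ (Finset.filter_congr fun j _ => ?_)
  rw [notMem_colSupport, mem_colSupport]

theorem sepBounded_colFamily {A : BinMatrix ρ κ} {p : ℕ} (hp : 0 < p) (hA : IsSimple A)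
    (hA' : ¬ HasConfig (F0p10 p) A) : SepBounded (p - 1) (colFamily A) := by
  intro u v h
  rw [← Finset.card_pos, card_sep_colFamily hA] at h
  rw [card_sep_colFamily hA]
  by_contra! hlt
  exact hA' (hasConfig_F0p10 (u := u) (v := v) (by omega) h)

/-- The upper bounds in the definition of an edge are automatic: each pattern occurs, so avoidance
bounds the opposite one. -/
theorem undirectedGraph_adj_iff {A : BinMatrix ρ κ} {p : ℕ} (hA : IsSimple A)
    (hF : SepBounded (p - 1) (colFamily A)) {u v : ρ} :
    (undirectedGraph p A).Adj u v ↔ Incomp (colFamily A) u v := by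
  simp only [undirectedGraph, DirEdge, Incomp, ← card_sep_colFamily hA, Finset.card_eq_zero,
    ← Finset.not_nonempty_iff_eq_empty]
  constructor
  · rintro ⟨hne, -, h₁, h₂⟩
    exact ⟨not_not.1 fun h => h₁ ⟨hne, h⟩, not_not.1 fun h => h₂ ⟨hne.symm, h⟩⟩
  · intro h
    exact ⟨Incomp.ne h, ⟨hF _ _ h.2, hF _ _ h.1⟩, fun h' => h'.2 h.1, fun h' => h'.2 h.2⟩

/-- Without induced paths adjacency is transitive on distinct vertices, so every walk shortens to an
edge or a point. -/
theorem isClique_supp_of_not_hasInducedPath {A : BinMatrix ρ κ} {p : ℕ} (hA : IsSimple A)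
    (hF : SepBounded (p - 1) (colFamily A)) (hno : ¬ HasInducedPath (colFamily A))
    (C : (undirectedGraph p A).ConnectedComponent) :
    (undirectedGraph p A).IsClique C.supp := by
  have key : ∀ u v, (undirectedGraph p A).Walk u v → u = v ∨ (undirectedGraph p A).Adj u v := by
    intro u v w
    induction w with
    | nil => exact Or.inl rfl
    | @cons a b e hab w ih =>
      by_cases hae : a = e
      · exact Or.inl hae
      rcases ih with rfl | hbe
      · exact Or.inr hab
      · refine Or.inr ?_
        rw [undirectedGraph_adj_iff hA hF] at *
        by_contra h
        exact hno ⟨a, b, e, hab, hbe, hae, h⟩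
  intro u hu v hv huv
  rw [SimpleGraph.ConnectedComponent.mem_supp_iff] at hu hv
  obtain ⟨w⟩ := SimpleGraph.ConnectedComponent.eq.1 (hu.trans hv.symm)
  exact (key u v w).resolve_left huv

end ForbConfig

theorem mainTheorem1 (p : ℕ) (hp3 : 3 ≤ p) (hp9 : p ≤ 9) (m n : ℕ)
    (A : ForbConfig.BinMatrix (Fin m) (Fin n))
    (hA : A ∈ ForbConfig.Avoid m n (ForbConfig.F0p10 p)) :
    ((∀ C : (ForbConfig.undirectedGraph p A).ConnectedComponent,
        (ForbConfig.undirectedGraph p A).IsClique C.supp) ∨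
      ForbConfig.HasDeletionOfCostAtLeastOne p A) ∧
    (n : ℚ) ≤ ForbConfig.c p * m + 1 := by
  obtain ⟨hsimple, havoid⟩ := hA
  have hF := ForbConfig.sepBounded_colFamily (by omega) hsimple havoid
  have hcard := ForbConfig.card_le_of_sepBounded hp3 hp9 Finset.univ (ForbConfig.colFamily A)
    (fun x _ => Finset.subset_univ x) hF
  rw [ForbConfig.card_colFamily hsimple, Finset.card_univ, Fintype.card_fin, Fintype.card_fin]
    at hcard
  refine ⟨?_, hcard.1⟩
  by_cases hP : ForbConfig.HasInducedPath (ForbConfig.colFamily A)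
  · have hc : 1 ≤ ForbConfig.c p := by
      interval_cases p <;> norm_num [ForbConfig.c]
    have : Nonempty (Fin m) := ⟨hP.choose⟩
    exact Or.inr (ForbConfig.hasDeletion_of_card_le hc (by simpa using hcard.2 hP))
  · exact Or.inl (ForbConfig.isClique_supp_of_not_hasInducedPath hsimple hF hP)
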